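/- **Theorem.** For every constant $\alpha\ge 1$ there are a randomized algorithm and a constant $c$ (both depending only on $\alpha$) such that the following holds for all integers $p,r\ge 1$, $q\ge 2$, all 0-1 matrices $A$ of size $p\times q$ and $B$ of size $q\times r$, and all real $\delta\in(0,\frac12)$. Let $N=pq+qr$. On input $(p,q,r,A,B,\delta)$ the algorithm always halts after at most $$c\cdot\frac{\log N}{\delta^2}\Bigl(N\log_{1+\delta}q+pr\,\log\log_{1+\delta}q\Bigr)$$ steps, and, with probability at least $1-N^{-\alpha}$, it outputs numbers $W_{ij}$ ($1\le i\le p$, $1\le j\le r$) all of which are $\delta$-approximations of the Hamming distances $\mathrm{ham}(A_{i*},B_{*j})$ between the $i$-th row of $A$ and the $j$-th column of $B$, i.e. $$\frac{\mathrm{ham}(A_{i*},B_{*j})}{1+\delta}\;\le\; W_{ij}\;\le\;(1+\delta)\,\mathrm{ham}(A_{i*},B_{*j}).$$ Here the machine model is the randomized word RAM with words of $O(\log N)$ bits: arithmetic and comparisons of words, memory accesses, and drawing a uniformly random element of $\{0,\dots,y-1\}$ for a word $y$ cost one step each. The matrices are given with one entry per word, the real number $\delta$ can be accessed only through comparisons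 (one step each) with fractions of two words, and each $W_{ij}$ is output as a fraction of two words. -/

import Mathlib

/-!
A randomized word RAM, programmed in a small structured language.

* A word is a natural number at most `M`; an operation whose result exceeds `M` is a fault
  (the program then has no execution).
* The machine has word registers and finitely many (those that the program names)
  random-access memory banks of words.
* Every node of an evaluated expression, and every executed instruction, costs one step.
* `rand` draws a uniformly random element of `{0, …, y - 1}`, independently of all other draws.
* A real parameter `δ` can be accessed only by comparing it with fractions of two words; there is
  no arithmetic on real numbers.
-/

namespace WordRAM

structure State where
  /-- word registers -/
  reg : ℕ → ℕ
  /-- `mem b a` is the word at address `a` of memory bank `b` -/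
  mem : ℕ → ℕ → ℕ
  /-- the number of random draws made so far -/
  draws : ℕ

inductive Expr where
  | const (n : ℕ)
  | reg (x : ℕ)
  | read (bank : ℕ) (addr : Expr)
  | add (a b : Expr)
  | sub (a b : Expr)
  | mul (a b : Expr)
  | div (a b : Expr)
  | mod (a b : Expr)

inductive Cond where
  | lt (a b : Expr)
  | eq (a b : Expr)
  /-- the test `a < b * δ` -/
  | ltDelta (a b : Expr)

inductive Prog where
  | skip
  | assign (x : ℕ) (e : Expr)
  | store (bank : ℕ) (addr e : Expr)
  | rand (x : ℕ) (e : Expr)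
  | seq (P Q : Prog)
  | ite (c : Cond) (P Q : Prog)
  | loop (c : Cond) (P : Prog)

/-- The word with value `n`, or a fault if `n` does not fit into a word. -/
def word (M n : ℕ) : Option ℕ := if n ≤ M then some n else none

/-- Value of an expression (`none` is a fault). Subtraction is truncated at `0`, division is
rounded down, and `x / 0 = 0`, `x % 0 = x`. -/
def Expr.eval (M : ℕ) (s : State) : Expr → Option ℕ
  | .const n => word M n
  | .reg x => some (s.reg x)
  | .read bank addr => (addr.eval M s).bind fun a => some (s.mem bank a)
  | .add a b => (a.eval M s).bind fun x => (b.eval M s).bind fun y => word M (x + y)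
  | .sub a b => (a.eval M s).bind fun x => (b.eval M s).bind fun y => word M (x - y)
  | .mul a b => (a.eval M s).bind fun x => (b.eval M s).bind fun y => word M (x * y)
  | .div a b => (a.eval M s).bind fun x => (b.eval M s).bind fun y => word M (x / y)
  | .mod a b => (a.eval M s).bind fun x => (b.eval M s).bind fun y => word M (x % y)

/-- Number of steps for evaluating an expression. -/
def Expr.cost : Expr → ℕ
  | .const _ => 1
  | .reg _ => 1
  | .read _ addr => addr.cost + 1
  | .add a b => a.cost + b.cost + 1
  | .sub a b => a.cost + b.cost + 1
  | .mul a b => a.cost + b.cost + 1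
  | .div a b => a.cost + b.cost + 1
  | .mod a b => a.cost + b.cost + 1

open Classical in
/-- Value of a test (`none` is a fault). -/
noncomputable def Cond.eval (M : ℕ) (δ : ℝ) (s : State) : Cond → Option Bool
  | .lt a b => (a.eval M s).bind fun x => (b.eval M s).bind fun y => some (decide (x < y))
  | .eq a b => (a.eval M s).bind fun x => (b.eval M s).bind fun y => some (decide (x = y))
  | .ltDelta a b =>
      (a.eval M s).bind fun x => (b.eval M s).bind fun y => some (decide ((x : ℝ) < y * δ))

/-- Number of steps for evaluating a test. -/
def Cond.cost : Cond → ℕ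
  | .lt a b => a.cost + b.cost + 1
  | .eq a b => a.cost + b.cost + 1
  | .ltDelta a b => a.cost + b.cost + 1

def State.setReg (s : State) (x v : ℕ) : State :=
  { s with reg := Function.update s.reg x v }

def State.setMem (s : State) (bank a v : ℕ) : State :=
  { s with mem := Function.update s.mem bank (Function.update (s.mem bank) a v) }

/-- A source of randomness: one point of `[0, 1]` for each draw. -/
abbrev Source : Type := ℕ → unitInterval

/-- The points of the source are independent and uniformly distributed in `[0, 1]`. -/
noncomputable def sourceMeasure : MeasureTheory.Measure Source :=
  MeasureTheory.Measure.infinitePi fun _ : ℕ =>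
    (MeasureTheory.volume : MeasureTheory.Measure unitInterval)

/-- The element of `{0, …, y - 1}` that a uniform point `u` of `[0, 1]` determines
(the minimum matters only for `u = 1`). -/
noncomputable def pick (u : unitInterval) (y : ℕ) : ℕ := min ⌊(u : ℝ) * y⌋₊ (y - 1)

/-- `Exec M δ ω P s s' T`: with words at most `M`, real parameter `δ` and source of randomness `ω`,
the program `P` started in state `s` halts in state `s'` after exactly `T` steps, without fault. -/
inductive Exec (M : ℕ) (δ : ℝ) (ω : Source) : Prog → State → State → ℕ → Prop where
  | skip (s : State) : Exec M δ ω .skip s s 1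
  | assign {s : State} {x : ℕ} {e : Expr} {v : ℕ} (he : e.eval M s = some v) :
      Exec M δ ω (.assign x e) s (s.setReg x v) (e.cost + 1)
  | store {s : State} {bank : ℕ} {addr e : Expr} {a v : ℕ}
      (ha : addr.eval M s = some a) (he : e.eval M s = some v) :
      Exec M δ ω (.store bank addr e) s (s.setMem bank a v) (addr.cost + e.cost + 1)
  | rand {s : State} {x : ℕ} {e : Expr} {y : ℕ} (he : e.eval M s = some y) :
      Exec M δ ω (.rand x e) s
        { s.setReg x (pick (ω s.draws) y) with draws := s.draws + 1 } (e.cost + 1)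
  | seq {P Q : Prog} {s s' s'' : State} {T T' : ℕ}
      (hP : Exec M δ ω P s s' T) (hQ : Exec M δ ω Q s' s'' T') :
      Exec M δ ω (.seq P Q) s s'' (T + T')
  | ite_true {c : Cond} {P Q : Prog} {s s' : State} {T : ℕ}
      (hc : c.eval M δ s = some true) (hP : Exec M δ ω P s s' T) :
      Exec M δ ω (.ite c P Q) s s' (c.cost + 1 + T)
  | ite_false {c : Cond} {P Q : Prog} {s s' : State} {T : ℕ}
      (hc : c.eval M δ s = some false) (hQ : Exec M δ ω Q s s' T) :
      Exec M δ ω (.ite c P Q) s s' (c.cost + 1 + T)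
  | loop_true {c : Cond} {P : Prog} {s s' s'' : State} {T T' : ℕ}
      (hc : c.eval M δ s = some true) (hP : Exec M δ ω P s s' T)
      (hL : Exec M δ ω (.loop c P) s' s'' T') :
      Exec M δ ω (.loop c P) s s'' (c.cost + 1 + T + T')
  | loop_false {c : Cond} {P : Prog} {s : State} (hc : c.eval M δ s = some false) :
      Exec M δ ω (.loop c P) s s (c.cost + 1)

/-- Halting state and number of steps are determined by the program, the initial state, and the
source of randomness. -/
theorem Exec.unique {M : ℕ} {δ : ℝ} {ω : Source} {P : Prog} {s s₁ s₂ : State} {T₁ T₂ : ℕ}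
    (h₁ : Exec M δ ω P s s₁ T₁) (h₂ : Exec M δ ω P s s₂ T₂) : s₁ = s₂ ∧ T₁ = T₂ := by
  induction h₁ generalizing s₂ T₂ with
  | skip s => cases h₂; exact ⟨rfl, rfl⟩
  | assign he => cases h₂ with | assign he' => simp_all
  | store ha he => cases h₂ with | store ha' he' => simp_all
  | rand he => cases h₂ with | rand he' => simp_all
  | seq hP hQ ihP ihQ =>
    cases h₂ with
    | seq hP' hQ' =>
      obtain ⟨rfl, rfl⟩ := ihP hP'
      obtain ⟨rfl, rfl⟩ := ihQ hQ'
      exact ⟨rfl, rfl⟩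
  | ite_true hc hP ih =>
    cases h₂ with
    | ite_true hc' hP' => obtain ⟨rfl, rfl⟩ := ih hP'; exact ⟨rfl, rfl⟩
    | ite_false hc' hQ' => simp_all
  | ite_false hc hQ ih =>
    cases h₂ with
    | ite_true hc' hP' => simp_all
    | ite_false hc' hQ' => obtain ⟨rfl, rfl⟩ := ih hQ'; exact ⟨rfl, rfl⟩
  | loop_true hc hP hL ihP ihL =>
    cases h₂ with
    | loop_true hc' hP' hL' =>
      obtain ⟨rfl, rfl⟩ := ihP hP'
      obtain ⟨rfl, rfl⟩ := ihL hL'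
      exact ⟨rfl, rfl⟩
    | loop_false hc' => simp_all
  | loop_false hc =>
    cases h₂ with
    | loop_true hc' hP' hL' => simp_all
    | loop_false hc' => exact ⟨rfl, rfl⟩

end WordRAM

namespace ApproxHamming

open WordRAM

/-- A 0-1 matrix in row-major order, one entry per word, followed by zeros. -/
def rowMajor {m n : ℕ} (X : Matrix (Fin m) (Fin n) (Fin 2)) (a : ℕ) : ℕ :=
  if h : a < m * n then (X (Fin.divNat ⟨a, h⟩) (Fin.modNat ⟨a, h⟩) : ℕ) else 0

/-- The input: registers `0, 1, 2` hold `p, q, r`, banks `0, 1` hold `A, B`, and every other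
register and memory cell is `0`. -/
def input {p q r : ℕ} (A : Matrix (Fin p) (Fin q) (Fin 2)) (B : Matrix (Fin q) (Fin r) (Fin 2)) :
    State where
  reg x := if x = 0 then p else if x = 1 then q else if x = 2 then r else 0
  mem b a := if b = 0 then rowMajor A a else if b = 1 then rowMajor B a else 0
  draws := 0

/-- `w` is a `δ`-approximation of the Hamming distance of `x` and `y`. -/
def IsApprox {d : ℕ} (δ : ℝ) (x y : Fin d → Fin 2) (w : ℝ) : Prop :=
  (hammingDist x y : ℝ) / (1 + δ) ≤ w ∧ w ≤ (1 + δ) * hammingDist x y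

/-- The output is correct: for all `i`, `j`, the words at address `i * r + j` of the banks `2` and
`3` are the numerator and the (nonzero) denominator of a `δ`-approximation of the Hamming distance
between row `i` of `A` and column `j` of `B`. -/
def OutputCorrect {p q r : ℕ} (A : Matrix (Fin p) (Fin q) (Fin 2))
    (B : Matrix (Fin q) (Fin r) (Fin 2)) (δ : ℝ) (s : State) : Prop :=
  ∀ (i : Fin p) (j : Fin r),
    s.mem 3 (i * r + j) ≠ 0 ∧
      IsApprox δ (A.row i) (B.col j)
        ((s.mem 2 (i * r + j) : ℝ) / (s.mem 3 (i * r + j) : ℝ))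

/-- The input size `N = pq + qr`. -/
def inputSize (p q r : ℕ) : ℕ := p * q + q * r

/-- `(log N / δ²) (N log_{1+δ} q + p r log log_{1+δ} q)`. -/
noncomputable def timeBound (p q r : ℕ) (δ : ℝ) : ℝ :=
  (Real.log (inputSize p q r) / δ ^ 2) *
    (inputSize p q r * Real.logb (1 + δ) q + p * r * Real.log (Real.logb (1 + δ) q))

end ApproxHamming

/-!
The Hamming distance of two 0-1 vectors `x`, `y` is the squared Euclidean norm of `x - y`, so it can
be estimated from random projections onto sign vectors. For a `k × q` matrix of random bits `b`, the
sketch of `x` has the entries `∑ t, (b l t xor x t)`. Because `b xor x = b + (-1) ^ b * x`, the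
`l`-th entries of the sketches of `x` and `y` differ by `Z l = ∑ t, (-1) ^ (b l t) * (x t - y t)`
(`cast_sketchEntry_sub`), and `Z l ^ 2` has expectation `h`, the Hamming distance. The program
sketches all rows of `A` and all columns of `B` with the same bits, in `O(k N)` steps, and then sums
`Z l ^ 2` over `l < k` for each of the `p r` pairs, in `O(k p r)` steps (`exec_program`). With
`k = O(log N / δ ^ 2)` this is within the time bound, as `log_{1+δ} q` and its logarithm are bounded
below by positive constants (`le_three_mul_timeBound`).

Concentration comes from a bound on `E exp (τ (c + Z) ^ 2)` for small `τ` of either sign, proved by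
revealing one sign at a time (`sum_exp_sq_le`). It gives a Chernoff bound
`2 exp (-k ε ^ 2 / 16)` for the probability of a relative error above `ε` (`card_bad_sketch_le`),
and a union bound over the pairs follows. Probabilities are computed by counting bit matrices
(`sourceMeasure_drawnBits_mem_le`).

As `δ` may be far too small for `1 / δ` to fit into a word, the precision is `ε = 1 / (4 D)` with `D`
the minimum of `q + 1` and the least integer above `1 / δ`, and the estimate is rounded to an
integer. If `1 < D δ`, rounding keeps the relative error below `δ / 2`; if `D = q + 1`, the
unrounded error is below `1 / 2`, so that the output is exact (`isApprox_round`).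

All phases of the program are single loops whose counter is decomposed by division with remainder
into the indices of the entries involved; `Exec.accumulate` reduces such a loop to sums over the
fibres of the address function.
-/

namespace WordRAM

/-! ### Derived rules for expressions and loops -/

section Rules

variable {M : ℕ} {δ : ℝ} {ω : Source} {s : State}

theorem Expr.eval_const {n : ℕ} (h : n ≤ M) : (Expr.const n).eval M s = some n := by
  simp [Expr.eval, word, h]

theorem Expr.eval_reg {x n : ℕ} (h : s.reg x = n) : (Expr.reg x).eval M s = some n := by
  simp [Expr.eval, h]

theorem Expr.eval_read {b x v : ℕ} {e : Expr} (he : e.eval M s = some x) (h : s.mem b x = v) :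
    (Expr.read b e).eval M s = some v := by
  simp [Expr.eval, he, h]

section

variable {e f : Expr} {x y : ℕ} (he : e.eval M s = some x) (hf : f.eval M s = some y)
include he hf

theorem Expr.eval_add (h : x + y ≤ M) : (Expr.add e f).eval M s = some (x + y) := by
  simp [Expr.eval, he, hf, word, h]

theorem Expr.eval_sub (h : x ≤ M) : (Expr.sub e f).eval M s = some (x - y) := by
  have : x - y ≤ M := (Nat.sub_le x y).trans h
  simp only [Expr.eval, he, hf, word, this, Option.bind_some, if_true]

theorem Expr.eval_mul (h : x * y ≤ M) : (Expr.mul e f).eval M s = some (x * y) := by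
  simp [Expr.eval, he, hf, word, h]

theorem Expr.eval_div (h : x ≤ M) : (Expr.div e f).eval M s = some (x / y) := by
  simp [Expr.eval, he, hf, word, (Nat.div_le_self x y).trans h]

theorem Expr.eval_mod (h : x ≤ M) : (Expr.mod e f).eval M s = some (x % y) := by
  simp [Expr.eval, he, hf, word, (Nat.mod_le x y).trans h]

theorem Cond.eval_lt : (Cond.lt e f).eval M δ s = some (decide (x < y)) := by
  simp [Cond.eval, he, hf]

end

/-- A loop that runs through the states `st 0, …, st m`. -/
theorem Exec.loop_of_states {c : Cond} {P : Prog} {B : ℕ} (m : ℕ) (st : ℕ → State)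
    (hc : ∀ n < m, c.eval M δ (st n) = some true) (hm : c.eval M δ (st m) = some false)
    (hP : ∀ n < m, ∃ T ≤ B, Exec M δ ω P (st n) (st (n + 1)) T) :
    ∃ T ≤ m * (B + c.cost + 1) + (c.cost + 1), Exec M δ ω (.loop c P) (st 0) (st m) T := by
  induction m generalizing st with
  | zero => exact ⟨_, by simp, .loop_false hm⟩
  | succ m ih =>
    obtain ⟨T, hT, hE⟩ := hP 0 (by omega)
    obtain ⟨T', hT', hE'⟩ := ih (fun n => st (n + 1)) (fun n hn => hc _ (by omega)) hm
      (fun n hn => hP _ (by omega))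
    exact ⟨_, by rw [Nat.succ_mul]; omega, .loop_true (hc 0 (by omega)) hE hE'⟩

/-- `for x < e do P`: the counter `x` runs through the values `0, …, e - 1`. -/
def Prog.forLoop (x : ℕ) (e : Expr) (P : Prog) : Prog :=
  .seq (.assign x (.const 0))
    (.loop (.lt (.reg x) e) (.seq P (.assign x (.add (.reg x) (.const 1)))))

/-- A `for` loop that runs through the states `st 0, …, st m`. -/
theorem Exec.forLoop {x : ℕ} {e : Expr} {P : Prog} {B : ℕ} (m : ℕ) (st : ℕ → State)
    (h0 : s.setReg x 0 = st 0) (hx : ∀ n ≤ m, (st n).reg x = n)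
    (he : ∀ n ≤ m, e.eval M (st n) = some m) (hM : m ≤ M)
    (hP : ∀ n < m, ∃ s', ∃ T ≤ B, Exec M δ ω P (st n) s' T ∧ s'.reg x = n ∧
      s'.setReg x (n + 1) = st (n + 1)) :
    ∃ T ≤ (m + 1) * (B + e.cost + 8), Exec M δ ω (Prog.forLoop x e P) s (st m) T := by
  have hcond : ∀ n ≤ m, (Cond.lt (.reg x) e).eval M δ (st n) = some (decide (n < m)) :=
    fun n hn => Cond.eval_lt (Expr.eval_reg (hx n hn)) (he n hn)
  obtain ⟨T, hT, hE⟩ := Exec.loop_of_states (M := M) (δ := δ) (ω := ω) (B := B + 4)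
    (c := .lt (.reg x) e) (P := .seq P (.assign x (.add (.reg x) (.const 1)))) m st
    (fun n hn => by simp [hcond n hn.le, hn]) (by simp [hcond m le_rfl]) (fun n hn => by
      obtain ⟨s', T, hT, hE, hr, hs⟩ := hP n hn
      refine ⟨T + 4, by omega, ?_⟩
      rw [← hs]
      exact .seq hE (.assign (Expr.eval_add (Expr.eval_reg hr) (Expr.eval_const (by omega))
        (by omega))))
  refine ⟨2 + T, ?_, .seq (.assign (Expr.eval_const (Nat.zero_le _))) (h0 ▸ hE)⟩
  have hcost : (Cond.lt (.reg x) e).cost = 1 + e.cost + 1 := rfl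
  rw [hcost] at hT
  calc 2 + T ≤ m * (B + e.cost + 7) + (e.cost + 5) := by
        have : B + 4 + (1 + e.cost + 1) + 1 = B + e.cost + 7 := by ring
        rw [this] at hT; omega
    _ ≤ (m + 1) * (B + e.cost + 8) := by nlinarith

/-- `for n < e do b[addr] := b[addr] + val`, with the counter `n` in register `x`. -/
def Prog.accumulate (x b : ℕ) (e addr val : Expr) : Prog :=
  .forLoop x e (.store b addr (.add (.read b addr) val))

/-- If the `n`-th iteration adds `g n` to the word at address `f n`, then in the end the sum
of `g` over each fibre of `f` has been added to the bank. -/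
theorem Exec.accumulate {x b : ℕ} {e addr val : Expr} (m : ℕ) (f g : ℕ → ℕ) (hM : m ≤ M)
    (he : ∀ t : State, (∀ y ≠ x, t.reg y = s.reg y) → e.eval M t = some m)
    (hval : ∀ n < m, ∀ t : State, (∀ y ≠ x, t.reg y = s.reg y) → t.reg x = n →
      (∀ b' ≠ b, t.mem b' = s.mem b') →
      addr.eval M t = some (f n) ∧ val.eval M t = some (g n))
    (hsum : ∀ a, s.mem b a + ∑ i ∈ Finset.range m with f i = a, g i ≤ M) :
    ∃ s', ∃ T ≤ (m + 1) * (2 * addr.cost + val.cost + e.cost + 11),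
      Exec M δ ω (Prog.accumulate x b e addr val) s s' T ∧
      (∀ y ≠ x, s'.reg y = s.reg y) ∧ s'.draws = s.draws ∧
      s'.mem = Function.update s.mem b
        (fun a => s.mem b a + ∑ i ∈ Finset.range m with f i = a, g i) := by
  let st : ℕ → State := fun n =>
    { reg := Function.update s.reg x n
      mem := Function.update s.mem b
        (fun a => s.mem b a + ∑ i ∈ Finset.range n with f i = a, g i)
      draws := s.draws }
  have hreg : ∀ n, ∀ y ≠ x, (st n).reg y = s.reg y := fun n y hy => by simp [st, hy]
  have hregx : ∀ n, (st n).reg x = n := fun n => by simp [st]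
  have hmem : ∀ n, ∀ b' ≠ b, (st n).mem b' = s.mem b' := fun n y hy => by simp [st, hy]
  obtain ⟨T, hT, hE⟩ := Exec.forLoop (M := M) (δ := δ) (ω := ω) (s := s) (x := x) (e := e)
    (P := .store b addr (.add (.read b addr) val)) (B := 2 * addr.cost + val.cost + 3) m st
    (by simp [st, State.setReg]) (fun n _ => hregx n) (fun n _ => he _ (hreg n)) hM
    (fun n hn => by
      obtain ⟨h1, h2⟩ := hval n hn (st n) (hreg n) (hregx n) (hmem n)
      have hb : (st n).mem b (f n) + g n
          = s.mem b (f n) + ∑ i ∈ Finset.range (n + 1) with f i = f n, g i := by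
        simp [st, Finset.range_add_one, Finset.filter_insert]
        ring
      refine ⟨_, addr.cost + (Expr.add (.read b addr) val).cost + 1, ?_,
        .store h1 (Expr.eval_add (Expr.eval_read h1 rfl) h2 ?_), ?_, ?_⟩
      · simp only [Expr.cost]; omega
      · rw [hb]
        refine le_trans ?_ (hsum (f n))
        gcongr
        omega
      · simp [State.setMem, hregx]
      · rw [hb]
        simp only [State.setReg, State.setMem, st, Function.update_idem, Function.update_self]
        congr 2
        funext a
        by_cases ha : a = f n
        · subst ha; simp
        · simp [ha, Finset.range_add_one, Finset.filter_insert, Ne.symm ha])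
  refine ⟨st m, T, hT.trans (le_of_eq (by ring)), hE, hreg m, rfl, rfl⟩

end Rules

end WordRAM

namespace ApproxHamming

/-! ### Concentration of the sign sketch -/

/-- The sign `(-1) ^ b` of a bit `b`. -/
def bitSign (b : Fin 2) : ℝ := 1 - 2 * ((b : ℕ) : ℝ)

theorem sum_fin_succ_fun {n : ℕ} (F : (Fin (n + 1) → Fin 2) → ℝ) :
    ∑ s, F s = ∑ s : Fin n → Fin 2, (F (Fin.cons 0 s) + F (Fin.cons 1 s)) := by
  rw [← (Fin.consEquiv fun _ : Fin (n + 1) => Fin 2).sum_comp, Fintype.sum_prod_type,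
    Fin.sum_univ_two, ← Finset.sum_add_distrib]
  rfl

/-- Averaging `exp (B x²)` over `x = c ± w`. -/
theorem exp_sq_add_exp_sq_le (B c w : ℝ) :
    Real.exp (B * (c + w) ^ 2) + Real.exp (B * (c - w) ^ 2)
      ≤ 2 * Real.exp (B * (c ^ 2 + w ^ 2) + 2 * B ^ 2 * c ^ 2 * w ^ 2) := by
  have h := Real.cosh_le_exp_half_sq (2 * B * c * w)
  rw [Real.cosh_eq] at h
  have e1 : Real.exp (B * (c + w) ^ 2)
      = Real.exp (B * (c ^ 2 + w ^ 2)) * Real.exp (2 * B * c * w) := by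
    rw [← Real.exp_add]; ring_nf
  have e2 : Real.exp (B * (c - w) ^ 2)
      = Real.exp (B * (c ^ 2 + w ^ 2)) * Real.exp (-(2 * B * c * w)) := by
    rw [← Real.exp_add]; ring_nf
  have e3 : Real.exp (B * (c ^ 2 + w ^ 2) + 2 * B ^ 2 * c ^ 2 * w ^ 2)
      = Real.exp (B * (c ^ 2 + w ^ 2)) * Real.exp ((2 * B * c * w) ^ 2 / 2) := by
    rw [← Real.exp_add]; ring_nf
  rw [e1, e2, e3]
  have := Real.exp_pos (B * (c ^ 2 + w ^ 2))
  nlinarith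

/-- The exponential moment of the square of a shifted Rademacher sum, for small `τ` of either sign.
Revealing one sign with weight `w` turns the coefficient `B` of `c²` into `B + 2 B² w²`,
which stays below `τ + 4 τ² ∑ w²`. -/
theorem sum_exp_sq_le {n : ℕ} (w : Fin n → ℝ) (c τ : ℝ) (h : |τ| * ∑ t, w t ^ 2 ≤ 1 / 10) :
    ∑ s : Fin n → Fin 2, Real.exp (τ * (c + ∑ t, bitSign (s t) * w t) ^ 2)
      ≤ 2 ^ n * Real.exp ((τ + 4 * τ ^ 2 * ∑ t, w t ^ 2) * (∑ t, w t ^ 2 + c ^ 2)) := by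
  induction n generalizing c with
  | zero => simp
  | succ n ih =>
    set v : Fin n → ℝ := fun t => w t.succ with hv
    set S := ∑ t, v t ^ 2 with hS
    have hS0 : 0 ≤ S := Finset.sum_nonneg fun _ _ => sq_nonneg _
    have hsum : ∑ t, w t ^ 2 = w 0 ^ 2 + S := by rw [Fin.sum_univ_succ]
    rw [hsum] at h ⊢
    have hS' : |τ| * S ≤ 1 / 10 := by
      nlinarith [mul_nonneg (abs_nonneg τ) (sq_nonneg (w 0))]
    set B := τ + 4 * τ ^ 2 * S with hB
    have hB2 : B ^ 2 ≤ 2 * τ ^ 2 := by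
      have h1 : |τ * S| ≤ 1 / 10 := by rwa [abs_mul, abs_of_nonneg hS0]
      have h2 := abs_le.1 h1
      have h3 : B = τ * (1 + 4 * (τ * S)) := by rw [hB]; ring
      have h4 : (1 + 4 * (τ * S)) ^ 2 ≤ 2 := by nlinarith
      rw [h3, mul_pow]
      nlinarith [sq_nonneg τ]
    rw [sum_fin_succ_fun, Finset.sum_add_distrib]
    have key : ∀ b : Fin 2, ∑ s : Fin n → Fin 2, Real.exp (τ * (c + ∑ t : Fin (n + 1),
        bitSign ((Fin.cons b s : Fin (n + 1) → Fin 2) t) * w t) ^ 2)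
        ≤ 2 ^ n * Real.exp (B * (S + (c + bitSign b * w 0) ^ 2)) := fun b => by
      simpa [Fin.sum_univ_succ, add_assoc, hv] using ih v (c + bitSign b * w 0) hS'
    refine (add_le_add (key 0) (key 1)).trans ?_
    have hstep := exp_sq_add_exp_sq_le B c (w 0)
    have s0 : bitSign 0 = 1 := by simp [bitSign]
    have s1 : bitSign 1 = -1 := by norm_num [bitSign]
    rw [s0, s1, one_mul, neg_one_mul, ← sub_eq_add_neg]
    have hfin : B * S + (B * (c ^ 2 + w 0 ^ 2) + 2 * B ^ 2 * c ^ 2 * w 0 ^ 2)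
        ≤ (τ + 4 * τ ^ 2 * (w 0 ^ 2 + S)) * (w 0 ^ 2 + S + c ^ 2) := by
      have h5 : (τ + 4 * τ ^ 2 * (w 0 ^ 2 + S)) = B + 4 * τ ^ 2 * w 0 ^ 2 := by rw [hB]; ring
      rw [h5]
      have h6 : 2 * B ^ 2 * (c ^ 2 * w 0 ^ 2) ≤ 4 * τ ^ 2 * (c ^ 2 * w 0 ^ 2) := by
        have : 0 ≤ c ^ 2 * w 0 ^ 2 := by positivity
        nlinarith
      have h7 : 0 ≤ 4 * τ ^ 2 * w 0 ^ 2 * (w 0 ^ 2 + S) := by positivity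
      nlinarith
    calc 2 ^ n * Real.exp (B * (S + (c + w 0) ^ 2)) + 2 ^ n * Real.exp (B * (S + (c - w 0) ^ 2))
        = 2 ^ n * (Real.exp (B * S) *
            (Real.exp (B * (c + w 0) ^ 2) + Real.exp (B * (c - w 0) ^ 2))) := by
          rw [mul_add B S, mul_add B S, Real.exp_add, Real.exp_add]; ring
      _ ≤ 2 ^ n * (Real.exp (B * S) *
            (2 * Real.exp (B * (c ^ 2 + w 0 ^ 2) + 2 * B ^ 2 * c ^ 2 * w 0 ^ 2))) := by gcongr
      _ = 2 ^ (n + 1) * Real.exp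
            (B * S + (B * (c ^ 2 + w 0 ^ 2) + 2 * B ^ 2 * c ^ 2 * w 0 ^ 2)) := by
          rw [Real.exp_add (B * S), pow_succ]; ring
      _ ≤ _ := by gcongr

/-- The exponential moment of the sketch with `k` independent rows. -/
theorem sum_exp_sketch_le {k n : ℕ} (w : Fin n → ℝ) (τ : ℝ) (h : |τ| * ∑ t, w t ^ 2 ≤ 1 / 10) :
    ∑ b : Fin k → Fin n → Fin 2, Real.exp (τ * ∑ l, (∑ t, bitSign (b l t) * w t) ^ 2)
      ≤ (2 ^ n) ^ k * Real.exp (k * ((τ + 4 * τ ^ 2 * ∑ t, w t ^ 2) * ∑ t, w t ^ 2)) := by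
  have h1 := sum_exp_sq_le w 0 τ h
  simp only [zero_add, ne_eq, OfNat.ofNat_ne_zero, not_false_eq_true, zero_pow, add_zero] at h1
  calc _ = ∑ b : Fin k → Fin n → Fin 2,
        ∏ l, Real.exp (τ * (∑ t, bitSign (b l t) * w t) ^ 2) := by
        simp only [Finset.mul_sum, Real.exp_sum]
    _ = (∑ s : Fin n → Fin 2, Real.exp (τ * (∑ t, bitSign (s t) * w t) ^ 2)) ^ k := by
        have := Finset.sum_prod_piFinset (ι := Fin k) Finset.univ
          (fun _ (s : Fin n → Fin 2) => Real.exp (τ * (∑ t, bitSign (s t) * w t) ^ 2))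
        rw [Fintype.piFinset_univ] at this
        rw [this]; simp
    _ ≤ _ := by
        rw [Real.exp_nat_mul, ← mul_pow]
        exact pow_le_pow_left₀ (Finset.sum_nonneg fun _ _ => (Real.exp_pos _).le) h1 k

open Classical in
/-- Chernoff bound for the sketch: all but a fraction `2 exp (-k ε² / 16)` of the sign matrices
give a relative error of at most `ε`. -/
theorem card_bad_sketch_le {k n : ℕ} (w : Fin n → ℝ) {ε : ℝ} (hε : 0 < ε) (hε' : ε ≤ 4 / 5) :
    ((Finset.univ.filter fun b : Fin k → Fin n → Fin 2 =>
        ε * (k * ∑ t, w t ^ 2)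
          < |∑ l, (∑ t, bitSign (b l t) * w t) ^ 2 - k * ∑ t, w t ^ 2|).card : ℝ)
      ≤ (2 ^ n) ^ k * (2 * Real.exp (-(k * ε ^ 2 / 16))) := by
  set S := ∑ t, w t ^ 2 with hS
  have hS0 : 0 ≤ S := Finset.sum_nonneg fun _ _ => sq_nonneg _
  rcases hS0.eq_or_lt with h0 | hpos
  · -- a vanishing vector has a vanishing sketch
    have hw : ∀ t, w t = 0 := fun t => by
      have := (Finset.sum_eq_zero_iff_of_nonneg fun i _ => sq_nonneg (w i)).1
        (hS.symm.trans h0.symm) t (Finset.mem_univ t)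
      exact pow_eq_zero_iff two_ne_zero |>.1 this
    rw [Finset.filter_false_of_mem (fun b _ => by simp [hw, ← h0])]
    simp only [Finset.card_empty, Nat.cast_zero]
    positivity
  · set V : (Fin k → Fin n → Fin 2) → ℝ := fun b => ∑ l, (∑ t, bitSign (b l t) * w t) ^ 2
    -- the minimizer of `-τ S ε + 4 (τ S)²`
    set τ := ε / 8 / S with hτ
    have hτS : τ * S = ε / 8 := by rw [hτ]; field_simp
    have hτ0 : 0 < τ := by positivity
    have up := sum_exp_sketch_le (k := k) w τ (by rw [abs_of_pos hτ0, ← hS, hτS]; linarith)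
    have lo := sum_exp_sketch_le (k := k) w (-τ)
      (by rw [abs_neg, abs_of_pos hτ0, ← hS, hτS]; linarith)
    rw [← hS] at up lo
    have e1 : (τ + 4 * τ ^ 2 * S) * S = ε / 8 + ε ^ 2 / 16 := by
      rw [add_mul, hτS]
      have : 4 * τ ^ 2 * S * S = 4 * (τ * S) ^ 2 := by ring
      rw [this, hτS]; ring
    have e2 : (-τ + 4 * (-τ) ^ 2 * S) * S = -(ε / 8) + ε ^ 2 / 16 := by
      rw [add_mul, neg_mul, hτS]
      have : 4 * (-τ) ^ 2 * S * S = 4 * (τ * S) ^ 2 := by ring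
      rw [this, hτS]; ring
    rw [e1] at up
    rw [e2] at lo
    have hterm : ∀ b, (if ε * (k * S) < |V b - k * S| then (1 : ℝ) else 0)
        ≤ Real.exp (τ * V b) * Real.exp (-(k * (ε / 8 + ε ^ 2 / 8)))
          + Real.exp (-τ * V b) * Real.exp (-(k * (-(ε / 8) + ε ^ 2 / 8))) := fun b => by
      rw [← Real.exp_add, ← Real.exp_add]
      split_ifs with hb
      · have hk : τ * (k * S) = k * (ε / 8) := by rw [mul_left_comm, hτS]
        rcases lt_abs.1 hb with hb | hb
        · refine le_add_of_le_of_nonneg (Real.one_le_exp ?_) (Real.exp_pos _).le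
          nlinarith [mul_lt_mul_of_pos_left hb hτ0]
        · refine le_add_of_nonneg_of_le (Real.exp_pos _).le (Real.one_le_exp ?_)
          nlinarith [mul_lt_mul_of_pos_left hb hτ0]
      · positivity
    rw [Finset.card_filter, Nat.cast_sum]
    calc ∑ b, ((if ε * (k * S) < |V b - k * S| then 1 else 0 : ℕ) : ℝ)
        ≤ ∑ b, (Real.exp (τ * V b) * Real.exp (-(k * (ε / 8 + ε ^ 2 / 8)))
          + Real.exp (-τ * V b) * Real.exp (-(k * (-(ε / 8) + ε ^ 2 / 8)))) :=
          Finset.sum_le_sum fun b _ => by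
            refine le_trans (le_of_eq ?_) (hterm b)
            split_ifs <;> simp
      _ ≤ (2 ^ n) ^ k * Real.exp (k * (ε / 8 + ε ^ 2 / 16))
            * Real.exp (-(k * (ε / 8 + ε ^ 2 / 8)))
          + (2 ^ n) ^ k * Real.exp (k * (-(ε / 8) + ε ^ 2 / 16))
            * Real.exp (-(k * (-(ε / 8) + ε ^ 2 / 8))) := by
          rw [Finset.sum_add_distrib, ← Finset.sum_mul, ← Finset.sum_mul]
          gcongr
      _ = _ := by
          rw [mul_assoc, mul_assoc, ← Real.exp_add, ← Real.exp_add]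
          ring_nf

/-! ### The law of the random bits -/

open WordRAM MeasureTheory

theorem pick_two_lt (u : unitInterval) : pick u 2 < 2 := by
  unfold pick; omega

theorem volume_pick_two_le (b : ℕ) : volume {u : unitInterval | pick u 2 = b} ≤ 1 / 2 := by
  have half : (2⁻¹ : ℝ) ∈ unitInterval := by constructor <;> norm_num
  have e2 : ENNReal.ofReal 2⁻¹ = 1 / 2 := by
    rw [ENNReal.ofReal_inv_of_pos two_pos]; simp
  rcases Nat.eq_zero_or_pos b with rfl | hb
  · refine (measure_mono (t := Set.Iio ⟨2⁻¹, half⟩) fun u hu => ?_).trans ?_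
    · have h0 : ⌊(u : ℝ) * (2 : ℕ)⌋₊ = 0 := by
        simp only [Set.mem_ofPred_eq, pick] at hu; omega
      have := Nat.floor_eq_zero.1 h0
      push_cast at this
      rw [Set.mem_Iio, ← Subtype.coe_lt_coe]
      show (u : ℝ) < 2⁻¹
      linarith
    · rw [unitInterval.volume_Iio, e2]
  · refine (measure_mono (t := Set.Ici ⟨2⁻¹, half⟩) fun u hu => ?_).trans ?_
    · have h0 : 1 ≤ ⌊(u : ℝ) * (2 : ℕ)⌋₊ := by
        simp only [Set.mem_ofPred_eq, pick] at hu; omega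
      have := (Nat.one_le_floor_iff _).1 h0
      push_cast at this
      rw [Set.mem_Ici, ← Subtype.coe_le_coe]
      show 2⁻¹ ≤ (u : ℝ)
      linarith
    · rw [unitInterval.volume_Ici]
      refine le_of_eq ?_
      rw [← e2]
      norm_num

/-- The first `k * n` draws from `{0, 1}`, arranged row by row in a matrix. -/
noncomputable def drawnBits (k n : ℕ) (ω : Source) (l : Fin k) (t : Fin n) : Fin 2 :=
  ⟨pick (ω (l * n + t)) 2, pick_two_lt _⟩

theorem measurableSet_pick_two (b : ℕ) : MeasurableSet {u : unitInterval | pick u 2 = b} := by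
  have : Measurable fun u : unitInterval => pick u 2 := by
    unfold pick
    exact (Nat.measurable_floor.comp (measurable_subtype_coe.mul_const _)).min measurable_const
  exact this (measurableSet_singleton b)

theorem sourceMeasure_drawnBits_eq_le {k n : ℕ} (b : Fin k → Fin n → Fin 2) :
    sourceMeasure {ω | drawnBits k n ω = b} ≤ ((1 : ENNReal) / 2) ^ (k * n) := by
  let β : ℕ → ℕ := fun a => if h : a < k * n then
    (b (Fin.divNat ⟨a, h⟩) (Fin.modNat ⟨a, h⟩) : ℕ) else 0
  refine (measure_mono (t := Set.pi (Finset.range (k * n) : Set ℕ)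
    fun a => {u : unitInterval | pick u 2 = β a}) ?_).trans ?_
  · intro ω hω a ha
    have ha' : a < k * n := by simpa using ha
    have h1 := congrFun (congrFun hω (Fin.divNat ⟨a, ha'⟩)) (Fin.modNat ⟨a, ha'⟩)
    have h2 := congrArg (Fin.val) h1
    simp only [drawnBits, Fin.coe_divNat, Fin.coe_modNat, Nat.div_add_mod'] at h2
    simp only [Set.mem_ofPred_eq, β, ha', dite_true]
    exact h2
  · unfold sourceMeasure
    rw [Measure.infinitePi_pi _ (fun a _ => measurableSet_pick_two _)]
    calc _ ≤ ∏ _a ∈ Finset.range (k * n), (1 / 2 : ENNReal) :=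
          Finset.prod_le_prod' fun a _ => volume_pick_two_le _
      _ = _ := by simp

/-- Probabilities of events that depend on the drawn bits only are bounded by counting. -/
theorem sourceMeasure_drawnBits_mem_le {k n : ℕ} (E : Finset (Fin k → Fin n → Fin 2)) :
    sourceMeasure {ω | drawnBits k n ω ∈ E} ≤ E.card * ((1 : ENNReal) / 2) ^ (k * n) := by
  have : {ω | drawnBits k n ω ∈ E} = ⋃ b ∈ E, {ω | drawnBits k n ω = b} := by
    ext ω; simp
  rw [this]
  refine (measure_biUnion_finset_le _ _).trans ?_
  refine (Finset.sum_le_sum fun b _ => sourceMeasure_drawnBits_eq_le b).trans ?_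
  simp

/-! ### Index arithmetic -/

theorem mul_add_div_of_lt {a b c : ℕ} (h : b < c) : (a * c + b) / c = a := by
  rw [mul_comm, Nat.mul_add_div (by omega), Nat.div_eq_of_lt h, add_zero]

theorem mul_add_mod_of_lt {a b c : ℕ} (h : b < c) : (a * c + b) % c = b := by
  rw [mul_comm, Nat.mul_add_mod, Nat.mod_eq_of_lt h]

theorem mul_add_lt_mul {a b m c : ℕ} (ha : a < m) (hb : b < c) : a * c + b < m * c :=
  calc a * c + b < a * c + c := by omega
    _ = (a + 1) * c := by ring
    _ ≤ m * c := Nat.mul_le_mul_right _ ha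

theorem sum_fibre_eq {m q : ℕ} {P : ℕ → Prop} [DecidablePred P] (g : ℕ → ℕ)
    (hg : Set.InjOn g (Finset.range q)) (hP : ∀ n, (n < m ∧ P n) ↔ ∃ t < q, g t = n)
    (f : ℕ → ℕ) : ∑ n ∈ Finset.range m with P n, f n = ∑ t ∈ Finset.range q, f (g t) := by
  rw [← Finset.sum_image hg]
  congr 1
  ext n
  simp [hP]

theorem sum_fibre_le {m G : ℕ} (P : ℕ → Prop) [DecidablePred P] {g : ℕ → ℕ}
    (hg : ∀ n < m, g n ≤ G) : ∑ n ∈ Finset.range m with P n, g n ≤ m * G := by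
  calc _ ≤ ∑ n ∈ Finset.range m, g n :=
        Finset.sum_le_sum_of_subset (Finset.filter_subset _ _)
    _ ≤ ∑ _n ∈ Finset.range m, G := Finset.sum_le_sum fun n hn => hg n (Finset.mem_range.1 hn)
    _ = m * G := by simp

theorem sum_fibre_div {m q a : ℕ} (ha : a < m) (f : ℕ → ℕ) :
    ∑ n ∈ Finset.range (m * q) with n / q = a, f n = ∑ t ∈ Finset.range q, f (a * q + t) := by
  refine sum_fibre_eq (fun t => a * q + t) (fun x _ y _ h => by simpa using h) (fun n => ?_) f
  constructor
  · rintro ⟨hn, rfl⟩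
    have hq : 0 < q := Nat.pos_of_ne_zero fun h => by simp [h] at hn
    exact ⟨n % q, Nat.mod_lt _ hq, Nat.div_add_mod' n q⟩
  · rintro ⟨t, ht, rfl⟩
    exact ⟨mul_add_lt_mul ha ht, mul_add_div_of_lt ht⟩

theorem sum_fibre_mod {m q a : ℕ} (ha : a < q) (f : ℕ → ℕ) :
    ∑ n ∈ Finset.range (m * q) with n % q = a, f n = ∑ l ∈ Finset.range m, f (l * q + a) := by
  have hq : 0 < q := by omega
  refine sum_fibre_eq (fun l => l * q + a) (fun x _ y _ h => ?_) (fun n => ?_) f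
  · have h : x * q + a = y * q + a := h
    exact Nat.eq_of_mul_eq_mul_right hq (by omega)
  · constructor
    · rintro ⟨hn, rfl⟩
      exact ⟨n / q, Nat.div_lt_of_lt_mul (by rwa [mul_comm]), Nat.div_add_mod' n q⟩
    · rintro ⟨l, hl, rfl⟩
      exact ⟨mul_add_lt_mul hl ha, mul_add_mod_of_lt ha⟩

theorem sum_fibre_div_mod {k q r l j : ℕ} (hl : l < k) (hj : j < r) (f : ℕ → ℕ) :
    ∑ n ∈ Finset.range (k * (q * r)) with n / (q * r) * r + n % r = l * r + j, f n
      = ∑ t ∈ Finset.range q, f ((l * q + t) * r + j) := by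
  have hr : 0 < r := by omega
  refine sum_fibre_eq (fun t => (l * q + t) * r + j) (fun x _ y _ h => ?_) (fun n => ?_) f
  · have h : (l * q + x) * r + j = (l * q + y) * r + j := h
    have := Nat.eq_of_mul_eq_mul_right hr (show (l * q + x) * r = (l * q + y) * r by omega)
    omega
  · constructor
    · rintro ⟨hn, h⟩
      have hq : 0 < q := Nat.pos_of_ne_zero fun h => by simp [h] at hn
      have h1 := congrArg (· / r) h
      have h2 := congrArg (· % r) h
      simp only [mul_add_div_of_lt (Nat.mod_lt n hr), mul_add_div_of_lt hj] at h1
      simp only [mul_add_mod_of_lt (Nat.mod_lt n hr), mul_add_mod_of_lt hj] at h2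
      refine ⟨n / r % q, Nat.mod_lt _ hq, ?_⟩
      show (l * q + n / r % q) * r + j = n
      rw [← h1, ← h2, mul_comm q r, ← Nat.div_div_eq_div_mul, Nat.div_add_mod', Nat.div_add_mod']
    · rintro ⟨t, ht, rfl⟩
      refine ⟨?_, ?_⟩
      · rw [← mul_assoc]
        exact mul_add_lt_mul (mul_add_lt_mul hl ht) hj
      · show ((l * q + t) * r + j) / (q * r) * r + ((l * q + t) * r + j) % r = l * r + j
        rw [mul_add_mod_of_lt hj, mul_comm q r, ← Nat.div_div_eq_div_mul, mul_add_div_of_lt hj,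
          mul_add_div_of_lt ht]

theorem rowMajor_apply {m n : ℕ} (X : Matrix (Fin m) (Fin n) (Fin 2)) (i : Fin m) (t : Fin n) :
    rowMajor X (i * n + t) = X i t := by
  have h : (i : ℕ) * n + t < m * n := mul_add_lt_mul i.2 t.2
  have h1 : Fin.divNat ⟨i * n + t, h⟩ = i := Fin.ext (mul_add_div_of_lt t.2)
  have h2 : Fin.modNat ⟨i * n + t, h⟩ = t := Fin.ext (mul_add_mod_of_lt t.2)
  rw [rowMajor, dif_pos h, h1, h2]

theorem rowMajor_le_one {m n : ℕ} (X : Matrix (Fin m) (Fin n) (Fin 2)) (a : ℕ) :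
    rowMajor X a ≤ 1 := by
  unfold rowMajor
  split_ifs
  · omega
  · exact Nat.zero_le _

/-! ### Setting up the parameters -/

/-- The input size `N = p q + q r`; registers `0, 1, 2` hold `p, q, r`. -/
def sizeExpr : Expr :=
  .add (.mul (.reg 0) (.reg 1)) (.mul (.reg 1) (.reg 2))

/-- Doubles a power of two until it reaches `N`: register `5` becomes `⌈log₂ N⌉`. -/
def logProg : Prog :=
  .seq (.assign 6 (.const 1))
    (.loop (.lt (.reg 6) sizeExpr)
      (.seq (.assign 6 (.add (.reg 6) (.reg 6))) (.assign 5 (.add (.reg 5) (.const 1)))))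

section

variable {M : ℕ} {δ : ℝ} {ω : Source} {s : State} {p q r k : ℕ}

theorem eval_sizeExpr (h0 : s.reg 0 = p) (h1 : s.reg 1 = q) (h2 : s.reg 2 = r)
    (hM : inputSize p q r ≤ M) : sizeExpr.eval M s = some (inputSize p q r) := by
  have hM' : p * q + q * r ≤ M := hM
  exact Expr.eval_add (Expr.eval_mul (Expr.eval_reg h0) (Expr.eval_reg h1) (by omega))
    (Expr.eval_mul (Expr.eval_reg h1) (Expr.eval_reg h2) (by omega)) hM

theorem exec_logProg (h0 : s.reg 0 = p) (h1 : s.reg 1 = q) (h2 : s.reg 2 = r) (h5 : s.reg 5 = 0)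
    (hN : 1 ≤ inputSize p q r) (hM : 2 * inputSize p q r ≤ M) :
    ∃ s', ∃ T ≤ (inputSize p q r + 1) * 21, Exec M δ ω logProg s s' T ∧
      (∀ y ≠ 5, y ≠ 6 → s'.reg y = s.reg y) ∧ s'.reg 5 = Nat.clog 2 (inputSize p q r) ∧
      s'.mem = s.mem ∧ s'.draws = s.draws := by
  set N := inputSize p q r
  let st : ℕ → State := fun n =>
    { s with reg := Function.update (Function.update s.reg 6 (2 ^ n)) 5 n }
  have e0 : s.setReg 6 1 = st 0 := by
    simp only [State.setReg, st, pow_zero]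
    congr 1
    funext y
    by_cases hy : y = 5
    · subst hy; simp [h5]
    · simp [hy]
  have hcond : ∀ n, (Cond.lt (.reg 6) sizeExpr).eval M δ (st n)
      = some (decide (n < Nat.clog 2 N)) := fun n => by
    rw [Cond.eval_lt (Expr.eval_reg (n := 2 ^ n) (by simp [st]))
      (eval_sizeExpr (p := p) (q := q) (r := r) (by simp [st, h0]) (by simp [st, h1])
        (by simp [st, h2]) (by omega))]
    congr 1
    exact decide_eq_decide.2 (Nat.lt_clog_iff_pow_lt one_lt_two).symm
  obtain ⟨T, hT, hE⟩ := Exec.loop_of_states (M := M) (δ := δ) (ω := ω) (B := 8)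
    (c := .lt (.reg 6) sizeExpr)
    (P := .seq (.assign 6 (.add (.reg 6) (.reg 6))) (.assign 5 (.add (.reg 5) (.const 1))))
    (Nat.clog 2 N) st (fun n hn => by simp [hcond, hn]) (by simp [hcond]) (fun n hn => by
      have hlt := (Nat.lt_clog_iff_pow_lt one_lt_two).1 hn
      have hnlt : n < 2 ^ n := Nat.lt_two_pow_self
      refine ⟨8, le_rfl, ?_⟩
      have e : ((st n).setReg 6 (2 ^ n + 2 ^ n)).setReg 5 (n + 1) = st (n + 1) := by
        simp only [State.setReg, st]
        congr 1
        funext y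
        by_cases hy : y = 5
        · subst hy; simp
        · by_cases hy' : y = 6
          · subst hy'; simp [pow_succ, mul_two]
          · simp [hy, hy']
      rw [← e]
      exact .seq (T := 4) (T' := 4)
        (.assign (Expr.eval_add (Expr.eval_reg (by simp [st])) (Expr.eval_reg (by simp [st]))
          (by omega)))
        (.assign (Expr.eval_add (Expr.eval_reg (by simp [st, State.setReg]))
          (Expr.eval_const (by omega)) (by omega))))
  refine ⟨st (Nat.clog 2 N), 2 + T, ?_,
    .seq (.assign (Expr.eval_const (by omega))) (e0 ▸ hE), ?_, by simp [st], rfl, rfl⟩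
  · have hc : (Cond.lt (.reg 6) sizeExpr).cost = 9 := rfl
    rw [hc] at hT
    have : Nat.clog 2 N ≤ N := Nat.clog_le_of_le_pow Nat.lt_two_pow_self.le
    omega
  · intro y h5 h6
    simp [st, h5, h6]

/-- The precision used: the least `D` with `1 < D δ`, but at most `q + 1`. -/
noncomputable def precision (q : ℕ) (δ : ℝ) : ℕ := min (q + 1) (⌊1 / δ⌋₊ + 1)

/-- Computes the precision in register `4`, by comparisons with `δ`. -/
def precisionProg : Prog :=
  .seq (.assign 4 (.const 1))
    (.forLoop 9 (.reg 1)
      (.ite (.ltDelta (.const 1) (.reg 4)) .skip (.assign 4 (.add (.reg 4) (.const 1)))))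

theorem one_lt_mul_iff (hδ : 0 < δ) (n : ℕ) : (1 : ℝ) < n * δ ↔ ⌊1 / δ⌋₊ + 1 ≤ n := by
  rw [Nat.add_one_le_iff, Nat.floor_lt (by positivity), div_lt_iff₀ hδ]

theorem exec_precisionProg (hδ : 0 < δ) (h1 : s.reg 1 = q) (hM : q + 1 ≤ M) :
    ∃ s', ∃ T ≤ (q + 1) * 19, Exec M δ ω precisionProg s s' T ∧
      (∀ y ≠ 4, y ≠ 9 → s'.reg y = s.reg y) ∧ s'.reg 4 = precision q δ ∧
      s'.mem = s.mem ∧ s'.draws = s.draws := by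
  let st : ℕ → State := fun n =>
    { s with reg := Function.update (Function.update s.reg 4 (precision n δ)) 9 n }
  have hz : precision 0 δ = 1 := by unfold precision; omega
  obtain ⟨T, hT, hE⟩ := Exec.forLoop (M := M) (δ := δ) (ω := ω) (s := s.setReg 4 1) (x := 9)
    (e := .reg 1) (P := .ite (.ltDelta (.const 1) (.reg 4)) .skip
      (.assign 4 (.add (.reg 4) (.const 1)))) (B := 8) q st
    (by simp [st, State.setReg, hz]) (by simp [st])
    (fun n _ => Expr.eval_reg (by simp [st, h1])) (by omega) (fun n hn => by
      have h4 : (st n).reg 4 = precision n δ := by simp [st]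
      have hc : (Cond.ltDelta (.const 1) (.reg 4)).eval M δ (st n)
          = some (decide ((1 : ℝ) < (precision n δ : ℕ) * δ)) := by
        have : (Expr.const 1).eval M (st n) = some 1 := Expr.eval_const (by omega)
        simp [Cond.eval, this, Expr.eval_reg h4]
      by_cases h : (1 : ℝ) < (precision n δ : ℕ) * δ
      · refine ⟨st n, 4 + 1, by omega, .ite_true (by simpa [h] using hc) (.skip _), by simp [st],
          ?_⟩
        rw [one_lt_mul_iff hδ] at h
        have : precision (n + 1) δ = precision n δ := by unfold precision at h ⊢; omega
        simp [st, State.setReg, this]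
      · refine ⟨(st n).setReg 4 (precision n δ + 1), 4 + 4, by omega,
          .ite_false (by simpa [h] using hc) (.assign (Expr.eval_add (Expr.eval_reg h4)
            (Expr.eval_const (by omega)) ?_)), by simp [st, State.setReg], ?_⟩
        · have : precision n δ ≤ n + 1 := min_le_left _ _
          omega
        rw [one_lt_mul_iff hδ] at h
        have : precision (n + 1) δ = precision n δ + 1 := by unfold precision at h ⊢; omega
        simp only [st, State.setReg, this]
        congr 1
        funext y
        by_cases hy : y = 9
        · subst hy; simp
        · by_cases hy' : y = 4
          · subst hy'; simp
          · simp [hy, hy'])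
  refine ⟨st q, 2 + T, ?_, .seq (.assign (Expr.eval_const (by omega))) hE, ?_, by simp [st],
    rfl, rfl⟩
  · simp only [Expr.cost] at hT
    nlinarith
  · intro y h4 h9
    simp [st, h4, h9]

/-! ### The sketches -/

/-- Draws the `k * q` random bits into bank `4`. -/
def drawProg : Prog :=
  .forLoop 9 (.mul (.reg 3) (.reg 1)) (.seq (.rand 8 (.const 2)) (.store 4 (.reg 9) (.reg 8)))

theorem exec_drawProg (h1 : s.reg 1 = q) (h3 : s.reg 3 = k) (hd : s.draws = 0)
    (hM : k * q ≤ M) (hM2 : 2 ≤ M) :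
    ∃ s', ∃ T ≤ (k * q + 1) * 16, Exec M δ ω drawProg s s' T ∧
      (∀ y ≠ 8, y ≠ 9 → s'.reg y = s.reg y) ∧
      s'.mem = Function.update s.mem 4
        (fun a => if a < k * q then pick (ω a) 2 else s.mem 4 a) := by
  let st : ℕ → State := fun n =>
    { reg := Function.update (Function.update s.reg 8
        (if n = 0 then s.reg 8 else pick (ω (n - 1)) 2)) 9 n
      mem := Function.update s.mem 4 (fun a => if a < n then pick (ω a) 2 else s.mem 4 a)
      draws := n }
  obtain ⟨T, hT, hE⟩ := Exec.forLoop (M := M) (δ := δ) (ω := ω) (s := s) (x := 9)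
    (e := .mul (.reg 3) (.reg 1))
    (P := .seq (.rand 8 (.const 2)) (.store 4 (.reg 9) (.reg 8))) (B := 5) (k * q) st
    (by
      simp only [State.setReg, st, hd]
      congr 1 <;> simp)
    (by simp [st])
    (fun n _ => Expr.eval_mul (Expr.eval_reg (by simp [st, h3])) (Expr.eval_reg (by simp [st, h1]))
      hM) hM (fun n hn => by
      refine ⟨_, 2 + 3, by omega, .seq (.rand (Expr.eval_const hM2))
        (.store (a := n) (v := pick (ω n) 2) (Expr.eval_reg (by simp [st, State.setReg]))
          (Expr.eval_reg (by simp [st, State.setReg]))), by simp [st, State.setReg, State.setMem],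
          ?_⟩
      simp only [State.setReg, State.setMem, st]
      congr 1
      · funext y
        by_cases hy : y = 9
        · subst hy; simp
        · by_cases hy' : y = 8
          · subst hy'; simp
          · simp [hy, hy']
      · simp only [Function.update_idem, Function.update_self]
        congr 1
        funext a
        by_cases ha : a = n
        · subst ha; simp
        · simp only [ne_eq, ha, not_false_eq_true, Function.update_of_ne]
          congr 1
          exact propext ⟨fun h => by omega, fun h => by omega⟩)
  refine ⟨st (k * q), T, hT, hE, fun y h8 h9 => by simp [st, h8, h9], rfl⟩

/-- In iteration `n = (l p + i) q + t` adds `b_{lt} xor A_{it}` to the word `(l, i)` of bank `5`. -/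
def rowSketchProg : Prog :=
  .accumulate 9 5 (.mul (.reg 3) (.mul (.reg 0) (.reg 1)))
    (.div (.reg 9) (.reg 1))
    (.mod (.add
      (.read 4 (.add (.mul (.div (.reg 9) (.mul (.reg 0) (.reg 1))) (.reg 1))
        (.mod (.reg 9) (.reg 1))))
      (.read 0 (.mod (.reg 9) (.mul (.reg 0) (.reg 1))))) (.const 2))

theorem exec_rowSketchProg (h0 : s.reg 0 = p) (h1 : s.reg 1 = q) (h3 : s.reg 3 = k)
    (hpq : p * q ≤ k * (p * q)) (hM : 2 * (k * (p * q)) ≤ M) (hM2 : 2 ≤ M)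
    (h5 : ∀ a, s.mem 5 a = 0) (hbit : ∀ a, s.mem 4 a ≤ 1) (hA : ∀ a, s.mem 0 a ≤ 1) :
    ∃ s', ∃ T ≤ (k * (p * q) + 1) * 50, Exec M δ ω rowSketchProg s s' T ∧
      (∀ y ≠ 9, s'.reg y = s.reg y) ∧
      s'.mem = Function.update s.mem 5
        (fun a => ∑ n ∈ Finset.range (k * (p * q)) with n / q = a,
          (s.mem 4 (n / (p * q) * q + n % q) + s.mem 0 (n % (p * q))) % 2) := by
  obtain ⟨s', T, hT, hE, hr, -, hm⟩ := Exec.accumulate (M := M) (δ := δ) (ω := ω) (s := s)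
    (x := 9) (b := 5) (e := .mul (.reg 3) (.mul (.reg 0) (.reg 1)))
    (addr := .div (.reg 9) (.reg 1))
    (val := .mod (.add
      (.read 4 (.add (.mul (.div (.reg 9) (.mul (.reg 0) (.reg 1))) (.reg 1))
        (.mod (.reg 9) (.reg 1))))
      (.read 0 (.mod (.reg 9) (.mul (.reg 0) (.reg 1))))) (.const 2))
    (k * (p * q)) (fun n => n / q)
    (fun n => (s.mem 4 (n / (p * q) * q + n % q) + s.mem 0 (n % (p * q))) % 2) (by omega)
    (fun t ht => Expr.eval_mul (Expr.eval_reg (by rw [ht 3 (by decide), h3]))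
      (Expr.eval_mul (Expr.eval_reg (by rw [ht 0 (by decide), h0]))
        (Expr.eval_reg (by rw [ht 1 (by decide), h1])) (by omega)) (by omega))
    (fun n hn t ht ht9 hmem => by
      have e9 : (Expr.reg 9).eval M t = some n := Expr.eval_reg ht9
      have e1 : (Expr.reg 1).eval M t = some q := Expr.eval_reg (by rw [ht 1 (by decide), h1])
      have e01 : (Expr.mul (.reg 0) (.reg 1)).eval M t = some (p * q) :=
        Expr.eval_mul (Expr.eval_reg (by rw [ht 0 (by decide), h0])) e1 (by omega)
      have hdiv : n / (p * q) * q ≤ n := by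
        rcases Nat.eq_zero_or_pos p with rfl | hp
        · simp at hn
        calc n / (p * q) * q ≤ n / (p * q) * (p * q) :=
              Nat.mul_le_mul_left _ (Nat.le_mul_of_pos_left q hp)
          _ ≤ n := Nat.div_mul_le_self _ _
      have hmod : n % q ≤ n := Nat.mod_le _ _
      have hb := hbit (n / (p * q) * q + n % q)
      have ha := hA (n % (p * q))
      exact ⟨Expr.eval_div e9 e1 (by omega), Expr.eval_mod (Expr.eval_add
        (Expr.eval_read (Expr.eval_add (Expr.eval_mul (Expr.eval_div e9 e01 (by omega)) e1
          (by omega)) (Expr.eval_mod e9 e1 (by omega)) (by omega)) (by rw [hmem 4 (by decide)]))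
        (Expr.eval_read (Expr.eval_mod e9 e01 (by omega)) (by rw [hmem 0 (by decide)]))
        (by omega)) (Expr.eval_const hM2) (by omega)⟩)
    (fun a => by
      rw [h5, zero_add]
      refine (sum_fibre_le (G := 1) _ fun n _ => ?_).trans (by omega)
      exact Nat.lt_succ_iff.1 (Nat.mod_lt _ two_pos))
  refine ⟨s', T, hT.trans ?_, hE, hr, ?_⟩
  · exact Nat.mul_le_mul_left _ (by simp [Expr.cost])
  · rw [hm]; simp [h5]

/-- In iteration `n = (l q + t) r + j` adds `b_{lt} xor B_{tj}` to the word `(l, j)` of bank `6`. -/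
def colSketchProg : Prog :=
  .accumulate 9 6 (.mul (.reg 3) (.mul (.reg 1) (.reg 2)))
    (.add (.mul (.div (.reg 9) (.mul (.reg 1) (.reg 2))) (.reg 2)) (.mod (.reg 9) (.reg 2)))
    (.mod (.add (.read 4 (.div (.reg 9) (.reg 2)))
      (.read 1 (.mod (.reg 9) (.mul (.reg 1) (.reg 2))))) (.const 2))

theorem exec_colSketchProg (h1 : s.reg 1 = q) (h2 : s.reg 2 = r) (h3 : s.reg 3 = k)
    (hqr : q * r ≤ k * (q * r)) (hM : 2 * (k * (q * r)) ≤ M) (hM2 : 2 ≤ M)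
    (h6 : ∀ a, s.mem 6 a = 0) (hbit : ∀ a, s.mem 4 a ≤ 1) (hB : ∀ a, s.mem 1 a ≤ 1) :
    ∃ s', ∃ T ≤ (k * (q * r) + 1) * 60, Exec M δ ω colSketchProg s s' T ∧
      (∀ y ≠ 9, s'.reg y = s.reg y) ∧
      s'.mem = Function.update s.mem 6
        (fun a => ∑ n ∈ Finset.range (k * (q * r)) with n / (q * r) * r + n % r = a,
          (s.mem 4 (n / r) + s.mem 1 (n % (q * r))) % 2) := by
  obtain ⟨s', T, hT, hE, hr, -, hm⟩ := Exec.accumulate (M := M) (δ := δ) (ω := ω) (s := s)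
    (x := 9) (b := 6) (e := .mul (.reg 3) (.mul (.reg 1) (.reg 2)))
    (addr := .add (.mul (.div (.reg 9) (.mul (.reg 1) (.reg 2))) (.reg 2))
      (.mod (.reg 9) (.reg 2)))
    (val := .mod (.add (.read 4 (.div (.reg 9) (.reg 2)))
      (.read 1 (.mod (.reg 9) (.mul (.reg 1) (.reg 2))))) (.const 2))
    (k * (q * r)) (fun n => n / (q * r) * r + n % r)
    (fun n => (s.mem 4 (n / r) + s.mem 1 (n % (q * r))) % 2) (by omega)
    (fun t ht => Expr.eval_mul (Expr.eval_reg (by rw [ht 3 (by decide), h3]))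
      (Expr.eval_mul (Expr.eval_reg (by rw [ht 1 (by decide), h1]))
        (Expr.eval_reg (by rw [ht 2 (by decide), h2])) (by omega)) (by omega))
    (fun n hn t ht ht9 hmem => by
      have e9 : (Expr.reg 9).eval M t = some n := Expr.eval_reg ht9
      have e2 : (Expr.reg 2).eval M t = some r := Expr.eval_reg (by rw [ht 2 (by decide), h2])
      have e12 : (Expr.mul (.reg 1) (.reg 2)).eval M t = some (q * r) :=
        Expr.eval_mul (Expr.eval_reg (by rw [ht 1 (by decide), h1])) e2 (by omega)
      have hdiv : n / (q * r) * r ≤ n := by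
        rcases Nat.eq_zero_or_pos q with rfl | hq
        · simp at hn
        calc n / (q * r) * r ≤ n / (q * r) * (q * r) :=
              Nat.mul_le_mul_left _ (Nat.le_mul_of_pos_left r hq)
          _ ≤ n := Nat.div_mul_le_self _ _
      have hmod : n % r ≤ n := Nat.mod_le _ _
      have hb := hbit (n / r)
      have ha := hB (n % (q * r))
      exact ⟨Expr.eval_add (Expr.eval_mul (Expr.eval_div e9 e12 (by omega)) e2
          (by omega)) (Expr.eval_mod e9 e2 (by omega)) (by omega), Expr.eval_mod (Expr.eval_add
        (Expr.eval_read (Expr.eval_div e9 e2 (by omega)) (by rw [hmem 4 (by decide)]))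
        (Expr.eval_read (Expr.eval_mod e9 e12 (by omega)) (by rw [hmem 1 (by decide)]))
        (by omega)) (Expr.eval_const hM2) (by omega)⟩)
    (fun a => by
      rw [h6, zero_add]
      refine (sum_fibre_le (G := 1) _ fun n _ => ?_).trans (by omega)
      exact Nat.lt_succ_iff.1 (Nat.mod_lt _ two_pos))
  refine ⟨s', T, hT.trans ?_, hE, hr, ?_⟩
  · exact Nat.mul_le_mul_left _ (by simp [Expr.cost])
  · rw [hm]; simp [h6]

/-- The square of the difference of two natural numbers, by truncated subtraction. -/
def distSq (u v : ℕ) : ℕ := (u - v) * (u - v) + (v - u) * (v - u)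

theorem cast_distSq (u v : ℕ) : (distSq u v : ℝ) = ((u : ℝ) - v) ^ 2 := by
  unfold distSq
  rcases le_total u v with h | h
  · rw [Nat.sub_eq_zero_of_le h]; push_cast [h]; ring
  · rw [Nat.sub_eq_zero_of_le h]; push_cast [h]; ring

theorem distSq_le {u v Y : ℕ} (hu : u ≤ Y) (hv : v ≤ Y) : distSq u v ≤ 2 * Y ^ 2 := by
  unfold distSq
  have h1 : u - v ≤ Y := by omega
  have h2 : v - u ≤ Y := by omega
  nlinarith [Nat.mul_le_mul h1 h1, Nat.mul_le_mul h2 h2]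

/-- The entry `(l, i)` of bank `5` in iteration `n = (l p + i) r + j`. -/
def rowEntryExpr : Expr := .read 5 (.div (.reg 9) (.reg 2))

/-- The entry `(l, j)` of bank `6` in iteration `n = (l p + i) r + j`. -/
def colEntryExpr : Expr :=
  .read 6 (.add (.mul (.div (.reg 9) (.mul (.reg 0) (.reg 2))) (.reg 2)) (.mod (.reg 9) (.reg 2)))

/-- In iteration `n = (l p + i) r + j` adds the squared difference of the `l`-th entries of the
sketches of `A_{i*}` and `B_{*j}` to the word `(i, j)` of bank `7`. -/
def distProg : Prog :=
  .accumulate 9 7 (.mul (.reg 3) (.mul (.reg 0) (.reg 2)))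
    (.mod (.reg 9) (.mul (.reg 0) (.reg 2)))
    (.add
      (.mul (.sub rowEntryExpr colEntryExpr) (.sub rowEntryExpr colEntryExpr))
      (.mul (.sub colEntryExpr rowEntryExpr) (.sub colEntryExpr rowEntryExpr)))

theorem exec_distProg {Y : ℕ} (h0 : s.reg 0 = p) (h2 : s.reg 2 = r) (h3 : s.reg 3 = k)
    (hpr : p * r ≤ k * (p * r)) (hY : k * (p * r) ≤ Y) (hM : 2 * Y ^ 3 ≤ M)
    (h7 : ∀ a, s.mem 7 a = 0) (h5 : ∀ a, s.mem 5 a ≤ Y) (h6 : ∀ a, s.mem 6 a ≤ Y) :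
    ∃ s', ∃ T ≤ (k * (p * r) + 1) * 100, Exec M δ ω distProg s s' T ∧
      (∀ y ≠ 9, s'.reg y = s.reg y) ∧
      s'.mem = Function.update s.mem 7
        (fun a => ∑ n ∈ Finset.range (k * (p * r)) with n % (p * r) = a,
          distSq (s.mem 5 (n / r)) (s.mem 6 (n / (p * r) * r + n % r))) := by
  have hY3 : Y ≤ Y ^ 3 := Nat.le_self_pow (by norm_num) Y
  have hY23 : Y ^ 2 ≤ Y ^ 3 := by
    rcases Nat.eq_zero_or_pos Y with rfl | h
    · norm_num
    · exact Nat.pow_le_pow_right h (by norm_num)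
  obtain ⟨s', T, hT, hE, hr, -, hm⟩ := Exec.accumulate (M := M) (δ := δ) (ω := ω) (s := s)
    (x := 9) (b := 7) (e := .mul (.reg 3) (.mul (.reg 0) (.reg 2)))
    (addr := .mod (.reg 9) (.mul (.reg 0) (.reg 2)))
    (val := .add
      (.mul (.sub rowEntryExpr colEntryExpr) (.sub rowEntryExpr colEntryExpr))
      (.mul (.sub colEntryExpr rowEntryExpr) (.sub colEntryExpr rowEntryExpr)))
    (k * (p * r)) (fun n => n % (p * r))
    (fun n => distSq (s.mem 5 (n / r)) (s.mem 6 (n / (p * r) * r + n % r))) (by omega)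
    (fun t ht => Expr.eval_mul (Expr.eval_reg (by rw [ht 3 (by decide), h3]))
      (Expr.eval_mul (Expr.eval_reg (by rw [ht 0 (by decide), h0]))
        (Expr.eval_reg (by rw [ht 2 (by decide), h2])) (by omega)) (by omega))
    (fun n hn t ht ht9 hmem => by
      have e9 : (Expr.reg 9).eval M t = some n := Expr.eval_reg ht9
      have e2 : (Expr.reg 2).eval M t = some r := Expr.eval_reg (by rw [ht 2 (by decide), h2])
      have e02 : (Expr.mul (.reg 0) (.reg 2)).eval M t = some (p * r) :=
        Expr.eval_mul (Expr.eval_reg (by rw [ht 0 (by decide), h0])) e2 (by omega)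
      have hdiv : n / (p * r) * r ≤ n := by
        rcases Nat.eq_zero_or_pos p with rfl | hp
        · simp at hn
        calc n / (p * r) * r ≤ n / (p * r) * (p * r) :=
              Nat.mul_le_mul_left _ (Nat.le_mul_of_pos_left r hp)
          _ ≤ n := Nat.div_mul_le_self _ _
      have hmod : n % r ≤ n := Nat.mod_le _ _
      have hu := h5 (n / r)
      have hv := h6 (n / (p * r) * r + n % r)
      have hd := distSq_le hu hv
      have eu : rowEntryExpr.eval M t = some (s.mem 5 (n / r)) :=
        Expr.eval_read (Expr.eval_div e9 e2 (by omega)) (by rw [hmem 5 (by decide)])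
      have ev : colEntryExpr.eval M t = some (s.mem 6 (n / (p * r) * r + n % r)) :=
        Expr.eval_read (Expr.eval_add (Expr.eval_mul (Expr.eval_div e9 e02 (by omega)) e2
          (by omega)) (Expr.eval_mod e9 e2 (by omega)) (by omega)) (by rw [hmem 6 (by decide)])
      unfold distSq at hd ⊢
      have euv := Expr.eval_sub eu ev (by omega)
      have evu := Expr.eval_sub ev eu (by omega)
      exact ⟨Expr.eval_mod e9 e02 (by omega), Expr.eval_add (Expr.eval_mul euv euv (by omega))
        (Expr.eval_mul evu evu (by omega)) (by omega)⟩)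
    (fun a => by
      rw [h7, zero_add]
      refine (sum_fibre_le (G := 2 * Y ^ 2) _ fun n _ => distSq_le (h5 _) (h6 _)).trans ?_
      calc k * (p * r) * (2 * Y ^ 2) ≤ Y * (2 * Y ^ 2) := Nat.mul_le_mul_right _ hY
        _ = 2 * Y ^ 3 := by ring
        _ ≤ M := hM)
  refine ⟨s', T, hT.trans ?_, hE, hr, ?_⟩
  · exact Nat.mul_le_mul_left _ (by simp [Expr.cost, rowEntryExpr, colEntryExpr])
  · rw [hm]; simp [h7]

/-- Writes the sums in bank `7`, divided by `k` and rounded to the nearest integer, as fractions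
with denominator `1`. -/
def outputProg : Prog :=
  .forLoop 9 (.mul (.reg 0) (.reg 2))
    (.seq (.store 2 (.reg 9) (.div (.add (.mul (.const 2) (.read 7 (.reg 9))) (.reg 3))
      (.mul (.const 2) (.reg 3)))) (.store 3 (.reg 9) (.const 1)))

theorem exec_outputProg {Y : ℕ} (h0 : s.reg 0 = p) (h2 : s.reg 2 = r) (h3 : s.reg 3 = k)
    (hM : 2 * Y + 2 * k ≤ M) (hpr : p * r ≤ M) (hM2 : 2 ≤ M) (h7 : ∀ a, s.mem 7 a ≤ Y) :
    ∃ s', ∃ T ≤ (p * r + 1) * 30, Exec M δ ω outputProg s s' T ∧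
      ∀ a < p * r, s'.mem 2 a = (2 * s.mem 7 a + k) / (2 * k) ∧ s'.mem 3 a = 1 := by
  let st : ℕ → State := fun n =>
    { reg := Function.update s.reg 9 n
      mem := Function.update (Function.update s.mem 2
        (fun a => if a < n then (2 * s.mem 7 a + k) / (2 * k) else s.mem 2 a)) 3
        (fun a => if a < n then 1 else s.mem 3 a)
      draws := s.draws }
  obtain ⟨T, hT, hE⟩ := Exec.forLoop (M := M) (δ := δ) (ω := ω) (s := s) (x := 9)
    (e := .mul (.reg 0) (.reg 2))
    (P := .seq (.store 2 (.reg 9) (.div (.add (.mul (.const 2) (.read 7 (.reg 9))) (.reg 3))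
      (.mul (.const 2) (.reg 3)))) (.store 3 (.reg 9) (.const 1))) (B := 15) (p * r) st
    (by
      simp only [State.setReg, st]
      congr 1
      simp)
    (by simp [st])
    (fun n _ => Expr.eval_mul (Expr.eval_reg (by simp [st, h0])) (Expr.eval_reg (by simp [st, h2]))
      hpr) hpr (fun n hn => by
      have h7n := h7 n
      have e9 : (Expr.reg 9).eval M (st n) = some n := Expr.eval_reg (by simp [st])
      have e3 : (Expr.reg 3).eval M (st n) = some k := Expr.eval_reg (by simp [st, h3])
      have ec : (Expr.const 2).eval M (st n) = some 2 := Expr.eval_const hM2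
      refine ⟨_, 12 + 3, by omega, .seq (.store e9 (Expr.eval_div (Expr.eval_add (Expr.eval_mul ec
        (Expr.eval_read e9 (v := s.mem 7 n) (by simp [st])) (by omega)) e3 (by omega))
          (Expr.eval_mul ec e3 (by omega)) (by omega)))
        (.store (a := n) (v := 1) (Expr.eval_reg (by simp [st, State.setMem]))
          (Expr.eval_const (by omega))), by simp [st, State.setMem], ?_⟩
      simp only [State.setReg, State.setMem, st]
      congr 1
      · simp
      · funext b a
        by_cases hb : b = 3
        · subst hb
          by_cases ha : a = n
          · subst ha; simp
          · have : a ≤ n ↔ a < n := by omega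
            simp [ha, this]
        · by_cases hb' : b = 2
          · subst hb'
            by_cases ha : a = n
            · subst ha; simp
            · have : a ≤ n ↔ a < n := by omega
              simp [ha, this]
          · simp [hb, hb'])
  refine ⟨st (p * r), T, hT.trans (Nat.mul_le_mul_left _ (by simp [Expr.cost])), hE, ?_⟩
  intro a ha
  simp [st, ha]

end

/-! ### The whole program -/

/-- The number `k = C ⌈log₂ N⌉ D²` of rows of the sketch. -/
noncomputable def sketchSize (C p q r : ℕ) (δ : ℝ) : ℕ :=
  C * Nat.clog 2 (inputSize p q r) * precision q δ * precision q δ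

/-- Approximates all Hamming distances between the rows of `A` and the columns of `B`. Register `3`
holds the number `k` of rows of the sketch, register `4` the precision `D`, register `5` the number
`⌈log₂ N⌉`; register `9` is the counter of all `for` loops. -/
def program (C : ℕ) : Prog :=
  .seq logProg (.seq precisionProg (.seq
    (.assign 3 (.mul (.mul (.mul (.const C) (.reg 5)) (.reg 4)) (.reg 4)))
    (.seq drawProg (.seq rowSketchProg (.seq colSketchProg (.seq distProg outputProg))))))

/-- The `l`-th entry of the sketch of the vector `x`, for the sequence of bits `β`. -/
def sketchEntry (q : ℕ) (β x : ℕ → ℕ) (l : ℕ) : ℕ :=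
  ∑ t ∈ Finset.range q, (β (l * q + t) + x t) % 2

section Program

variable {M : ℕ} {δ : ℝ} {ω : Source} {C p q r : ℕ}

theorem one_le_precision : 1 ≤ precision q δ := by
  unfold precision; omega

theorem le_sketchSize (hN : 2 ≤ inputSize p q r) : C ≤ sketchSize C p q r δ := by
  have hL : 1 ≤ Nat.clog 2 (inputSize p q r) := Nat.clog_pos one_lt_two hN
  have hD : 1 ≤ precision q δ := one_le_precision
  exact (Nat.le_mul_of_pos_right _ hL).trans ((Nat.le_mul_of_pos_right _ hD).trans
    (Nat.le_mul_of_pos_right _ hD))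

theorem four_le_inputSize (hp : 1 ≤ p) (hq : 2 ≤ q) (hr : 1 ≤ r) : 4 ≤ inputSize p q r := by
  unfold inputSize; nlinarith

/-- The program halts without fault, in `O(k (N + p r))` steps, and computes the rounded means of
the squared differences of the sketches. -/
theorem exec_program (hp : 1 ≤ p) (hq : 2 ≤ q) (hr : 1 ≤ r) (hδ : 0 < δ) (hC : 1 ≤ C)
    (A : Matrix (Fin p) (Fin q) (Fin 2)) (B : Matrix (Fin q) (Fin r) (Fin 2))
    (hM : 8 * (sketchSize C p q r δ * (inputSize p q r * inputSize p q r)) ^ 3 ≤ M) :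
    ∃ s, ∃ T ≤ 1000 * (sketchSize C p q r δ * (inputSize p q r + p * r)),
      Exec M δ ω (program C) (input A B) s T ∧
      ∃ β : ℕ → ℕ, (∀ a < sketchSize C p q r δ * q, β a = pick (ω a) 2) ∧
      ∀ i < p, ∀ j < r, s.mem 3 (i * r + j) = 1 ∧ s.mem 2 (i * r + j) =
        (2 * ∑ l ∈ Finset.range (sketchSize C p q r δ),
          distSq (sketchEntry q β (fun t => rowMajor A (i * q + t)) l)
            (sketchEntry q β (fun t => rowMajor B (t * r + j)) l) + sketchSize C p q r δ)
          / (2 * sketchSize C p q r δ) := by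
  set N := inputSize p q r with hN
  have hN' : N = p * q + q * r := rfl
  have hN4 : 4 ≤ N := four_le_inputSize hp hq hr
  set k := sketchSize C p q r δ with hk
  set Y := k * (N * N) with hY
  have hCk : C ≤ k := le_sketchSize (by omega)
  have hk1 : 1 ≤ k := hC.trans hCk
  -- all words that occur are bounded in terms of `Y`
  have hNN : 4 * N ≤ N * N := Nat.mul_le_mul_right _ hN4
  have hYle : ∀ x ≤ N * N, k * x ≤ Y := fun x hx => Nat.mul_le_mul_left _ hx
  have hle : ∀ x : ℕ, x ≤ k * x := fun x => Nat.le_mul_of_pos_left x hk1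
  have hpq : p * q ≤ N := by omega
  have hqr : q * r ≤ N := by omega
  have hqN : q ≤ N := (Nat.le_mul_of_pos_left q hp).trans hpq
  have hpr : p * r ≤ N * N := Nat.mul_le_mul ((Nat.le_mul_of_pos_right p (by omega)).trans hpq)
    ((Nat.le_mul_of_pos_left r (by omega)).trans hqr)
  have b1 : k * q ≤ Y := hYle _ (by omega)
  have b2 : k * (p * q) ≤ Y := hYle _ (by omega)
  have b3 : k * (q * r) ≤ Y := hYle _ (by omega)
  have b4 : k * (p * r) ≤ Y := hYle _ hpr
  have b5 : N * N ≤ Y := hle _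
  have b6 : k ≤ Y := Nat.le_mul_of_pos_right _ (by omega)
  have b7 := hle (p * q)
  have b8 := hle (q * r)
  have b9 := hle (p * r)
  have hY3 : Y ≤ Y ^ 3 := Nat.le_self_pow (by norm_num) Y
  obtain ⟨s1, T1, hT1, E1, r1, r15, m1, d1⟩ := exec_logProg (M := M) (δ := δ) (ω := ω)
    (s := input A B) (p := p) (q := q) (r := r) (by simp [input]) (by simp [input])
    (by simp [input]) (by simp [input]) (by omega) (by omega)
  obtain ⟨s2, T2, hT2, E2, r2, r24, m2, d2⟩ := exec_precisionProg (M := M) (δ := δ) (ω := ω)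
    (s := s1) (q := q) hδ (by rw [r1 1 (by decide) (by decide)]; simp [input]) (by omega)
  have hreg2 : ∀ y ≤ 2, s2.reg y = (input A B).reg y := fun y hy => by
    rw [r2 y (by omega) (by omega), r1 y (by omega) (by omega)]
  have r25 : s2.reg 5 = Nat.clog 2 N := by rw [r2 5 (by decide) (by decide), r15]
  have E3 : Exec M δ ω (.assign 3 (.mul (.mul (.mul (.const C) (.reg 5)) (.reg 4)) (.reg 4)))
      s2 (s2.setReg 3 k) 8 := by
    have hk' : C * Nat.clog 2 N * precision q δ * precision q δ = k := rfl
    have hD : 1 ≤ precision q δ := one_le_precision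
    have c2 : C * Nat.clog 2 N * precision q δ ≤ k := hk' ▸ Nat.le_mul_of_pos_right _ hD
    have c1 : C * Nat.clog 2 N ≤ k := (Nat.le_mul_of_pos_right _ hD).trans c2
    have hCM : C ≤ M := by omega
    have he := Expr.eval_mul (Expr.eval_mul (Expr.eval_mul (Expr.eval_const (s := s2) hCM)
      (Expr.eval_reg r25) (by omega)) (Expr.eval_reg r24) (by omega)) (Expr.eval_reg r24)
      (by omega)
    exact .assign he
  set s3 := s2.setReg 3 k
  have r33 : s3.reg 3 = k := by simp [s3, State.setReg]
  have hreg3 : ∀ y ≤ 2, s3.reg y = (input A B).reg y := fun y hy => by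
    have : y ≠ 3 := by omega
    simp [s3, State.setReg, this, hreg2 y hy]
  have m3 : s3.mem = (input A B).mem := by
    show s2.mem = _
    rw [m2, m1]
  have d3 : s3.draws = 0 := by
    show s2.draws = 0
    rw [d2, d1]; rfl
  have i0 : (input A B).reg 0 = p := by simp [input]
  have i1 : (input A B).reg 1 = q := by simp [input]
  have i2 : (input A B).reg 2 = r := by simp [input]
  obtain ⟨s4, T4, hT4, E4, r4, m4⟩ := exec_drawProg (M := M) (δ := δ) (ω := ω) (s := s3)
    (q := q) (k := k) (by rw [hreg3 1 (by decide), i1]) r33 d3 (by omega) (by omega)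
  have hreg4 : ∀ y ≤ 2, s4.reg y = (input A B).reg y := fun y hy => by
    rw [r4 y (by omega) (by omega), hreg3 y hy]
  have r43 : s4.reg 3 = k := by rw [r4 3 (by decide) (by decide), r33]
  have z : ∀ b a, 2 ≤ b → (input A B).mem b a = 0 := fun b a hb => by
    have h0 : b ≠ 0 := by omega
    have h1 : b ≠ 1 := by omega
    simp [input, h0, h1]
  have iA : (input A B).mem 0 = rowMajor A := by funext a; simp [input]
  have iB : (input A B).mem 1 = rowMajor B := by funext a; simp [input]
  set β : ℕ → ℕ := s4.mem 4 with hβ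
  have m4' : ∀ b ≠ 4, s4.mem b = (input A B).mem b := fun b hb => by
    rw [m4, Function.update_of_ne hb, m3]
  have hβ' : β = fun a => if a < k * q then pick (ω a) 2 else 0 := by
    rw [hβ, m4, Function.update_self]
    funext a
    rw [m3, z 4 a (by decide)]
  have hβ1 : ∀ a, β a ≤ 1 := fun a => by
    have := pick_two_lt (ω a)
    rw [hβ']
    dsimp only
    split_ifs <;> omega
  obtain ⟨s5, T5, hT5, E5, r5, m5⟩ := exec_rowSketchProg (M := M) (δ := δ) (ω := ω) (s := s4)
    (p := p) (q := q) (k := k) (by rw [hreg4 0 (by decide), i0]) (by rw [hreg4 1 (by decide), i1])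
    r43 b7 (by omega) (by omega) (fun a => by rw [m4' 5 (by decide), z 5 a (by decide)]) hβ1
    (fun a => by rw [m4' 0 (by decide), iA]; exact rowMajor_le_one A a)
  rw [← hβ, m4' 0 (by decide), iA] at m5
  have hreg5 : ∀ y ≤ 2, s5.reg y = (input A B).reg y := fun y hy => by
    rw [r5 y (by omega), hreg4 y hy]
  have r53 : s5.reg 3 = k := by rw [r5 3 (by decide), r43]
  have m5' : ∀ b ≠ 5, s5.mem b = s4.mem b := fun b hb => by rw [m5, Function.update_of_ne hb]
  obtain ⟨s6, T6, hT6, E6, r6, m6⟩ := exec_colSketchProg (M := M) (δ := δ) (ω := ω) (s := s5)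
    (q := q) (r := r) (k := k) (by rw [hreg5 1 (by decide), i1]) (by rw [hreg5 2 (by decide), i2])
    r53 b8 (by omega) (by omega)
    (fun a => by rw [m5' 6 (by decide), m4' 6 (by decide), z 6 a (by decide)])
    (fun a => by rw [m5' 4 (by decide)]; exact hβ1 a)
    (fun a => by rw [m5' 1 (by decide), m4' 1 (by decide), iB]; exact rowMajor_le_one B a)
  rw [m5' 4 (by decide), ← hβ, m5' 1 (by decide), m4' 1 (by decide), iB] at m6
  have hreg6 : ∀ y ≤ 2, s6.reg y = (input A B).reg y := fun y hy => by
    rw [r6 y (by omega), hreg5 y hy]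
  have r63 : s6.reg 3 = k := by rw [r6 3 (by decide), r53]
  have m6' : ∀ b ≠ 6, s6.mem b = s5.mem b := fun b hb => by rw [m6, Function.update_of_ne hb]
  have m65 : s6.mem 5 = fun a => ∑ n ∈ Finset.range (k * (p * q)) with n / q = a,
      (β (n / (p * q) * q + n % q) + rowMajor A (n % (p * q))) % 2 := by
    rw [m6' 5 (by decide), m5, Function.update_self]
  have m66 : s6.mem 6 = fun a => ∑ n ∈ Finset.range (k * (q * r)) with
      n / (q * r) * r + n % r = a, (β (n / r) + rowMajor B (n % (q * r))) % 2 := by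
    rw [m6, Function.update_self]
  have bnd5 : ∀ a, s6.mem 5 a ≤ Y := fun a => by
    rw [m65]
    refine (sum_fibre_le (G := 1) _ fun n _ => ?_).trans (by omega)
    exact Nat.lt_succ_iff.1 (Nat.mod_lt _ two_pos)
  have bnd6 : ∀ a, s6.mem 6 a ≤ Y := fun a => by
    rw [m66]
    refine (sum_fibre_le (G := 1) _ fun n _ => ?_).trans (by omega)
    exact Nat.lt_succ_iff.1 (Nat.mod_lt _ two_pos)
  obtain ⟨s7, T7, hT7, E7, r7, m7⟩ := exec_distProg (M := M) (δ := δ) (ω := ω) (s := s6)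
    (p := p) (r := r) (k := k) (Y := Y) (by rw [hreg6 0 (by decide), i0])
    (by rw [hreg6 2 (by decide), i2]) r63 b9 b4 (by omega)
    (fun a => by
      rw [m6' 7 (by decide), m5' 7 (by decide), m4' 7 (by decide), z 7 a (by decide)]) bnd5 bnd6
  have hreg7 : ∀ y ≤ 2, s7.reg y = (input A B).reg y := fun y hy => by
    rw [r7 y (by omega), hreg6 y hy]
  have m77 : s7.mem 7 = fun a => ∑ n ∈ Finset.range (k * (p * r)) with n % (p * r) = a,
      distSq (s6.mem 5 (n / r)) (s6.mem 6 (n / (p * r) * r + n % r)) := by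
    rw [m7, Function.update_self]
  obtain ⟨s8, T8, hT8, E8, m8⟩ := exec_outputProg (M := M) (δ := δ) (ω := ω) (s := s7)
    (p := p) (r := r) (k := k) (Y := 2 * Y ^ 3) (by rw [hreg7 0 (by decide), i0])
    (by rw [hreg7 2 (by decide), i2]) (by rw [r7 3 (by decide), r63]) (by omega) (by omega)
    (by omega) (fun a => by
      rw [m77]
      refine (sum_fibre_le (G := 2 * Y ^ 2) _ fun n _ => distSq_le (bnd5 _) (bnd6 _)).trans ?_
      calc k * (p * r) * (2 * Y ^ 2) ≤ Y * (2 * Y ^ 2) := Nat.mul_le_mul_right _ b4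
        _ = 2 * Y ^ 3 := by ring)
  refine ⟨s8, _, ?_, .seq E1 (.seq E2 (.seq E3 (.seq E4 (.seq E5 (.seq E6 (.seq E7 E8)))))), β,
    fun a ha => by rw [hβ']; simp [ha], ?_⟩
  · have c0 : k * N = k * (p * q) + k * (q * r) := by rw [hN']; ring
    have c1 : k * q ≤ k * N := Nat.mul_le_mul_left _ hqN
    have c2 := hle N
    rw [mul_add k]
    omega
  · intro i hi j hj
    obtain ⟨h2, h3⟩ := m8 (i * r + j) (mul_add_lt_mul hi hj)
    refine ⟨h3, h2.trans ?_⟩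
    congr 3
    rw [m77]
    dsimp only
    rw [sum_fibre_mod (mul_add_lt_mul hi hj)]
    refine Finset.sum_congr rfl fun l hl => ?_
    have hl : l < k := Finset.mem_range.1 hl
    have e1 : (l * (p * r) + (i * r + j)) / r = l * p + i := by
      rw [show l * (p * r) + (i * r + j) = (l * p + i) * r + j by ring]
      exact mul_add_div_of_lt hj
    have e2 : (l * (p * r) + (i * r + j)) % r = j := by
      rw [show l * (p * r) + (i * r + j) = (l * p + i) * r + j by ring]
      exact mul_add_mod_of_lt hj
    have e3 : (l * (p * r) + (i * r + j)) / (p * r) = l :=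
      mul_add_div_of_lt (mul_add_lt_mul hi hj)
    rw [e1, e2, e3]
    congr 1
    · rw [m65]
      dsimp only
      rw [← mul_assoc k p q, sum_fibre_div (mul_add_lt_mul hl hi)]
      refine Finset.sum_congr rfl fun t ht => ?_
      have ht : t < q := Finset.mem_range.1 ht
      have f1 : (l * p + i) * q + t = l * (p * q) + (i * q + t) := by ring
      rw [mul_add_mod_of_lt ht, f1, mul_add_div_of_lt (mul_add_lt_mul hi ht),
        mul_add_mod_of_lt (mul_add_lt_mul hi ht)]
    · rw [m66]
      dsimp only
      rw [sum_fibre_div_mod hl hj]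
      refine Finset.sum_congr rfl fun t ht => ?_
      have ht : t < q := Finset.mem_range.1 ht
      have f1 : (l * q + t) * r + j = l * (q * r) + (t * r + j) := by ring
      rw [mul_add_div_of_lt hj, f1, mul_add_mod_of_lt (mul_add_lt_mul ht hj)]

end Program

/-! ### Correctness of the output -/

theorem cast_sketchEntry_sub {q : ℕ} {β x y : ℕ → ℕ} {l : ℕ} {b x' y' : Fin q → Fin 2}
    (hβ : ∀ t : Fin q, β (l * q + t) = b t) (hx : ∀ t : Fin q, x t = x' t)
    (hy : ∀ t : Fin q, y t = y' t) :
    (sketchEntry q β x l : ℝ) - sketchEntry q β y l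
      = ∑ t, bitSign (b t) * (((x' t : ℕ) : ℝ) - ((y' t : ℕ) : ℝ)) := by
  -- `b xor x = b + (-1) ^ b * x`
  have hxor : ∀ b x : Fin 2, ((((b : ℕ) + (x : ℕ)) % 2 : ℕ) : ℝ)
      = (b : ℕ) + bitSign b * (x : ℕ) := by
    intro b x
    fin_cases b <;> fin_cases x <;> norm_num [bitSign]
  unfold sketchEntry
  rw [Finset.sum_range, Finset.sum_range]
  push_cast
  rw [← Finset.sum_sub_distrib]
  refine Finset.sum_congr rfl fun t _ => ?_
  rw [hβ, hx, hy]
  have h1 := hxor (b t) (x' t)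
  have h2 := hxor (b t) (y' t)
  rw [h1, h2]
  ring

theorem sum_sq_sub_eq_hammingDist {q : ℕ} (x y : Fin q → Fin 2) :
    ∑ t, (((x t : ℕ) : ℝ) - ((y t : ℕ) : ℝ)) ^ 2 = hammingDist x y := by
  have h : ∀ a b : Fin 2, (((a : ℕ) : ℝ) - ((b : ℕ) : ℝ)) ^ 2 = if a ≠ b then 1 else 0 := by
    intro a b
    fin_cases a <;> fin_cases b <;> norm_num
  simp only [h, hammingDist, Finset.sum_boole]

/-- Rounding an approximation with relative error `1 / (4 D)` to an integer at most doubles the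
error; distances below `2 D`, in particular all distances if `D` exceeds the dimension, become
exact. -/
theorem isApprox_round {q k D V : ℕ} {δ : ℝ} (hδ : 0 < δ) (hδ' : δ < 1 / 2) (hk : 1 ≤ k)
    (hD : 1 ≤ D) (hDq : q ≤ D ∨ (1 : ℝ) < D * δ) (x y : Fin q → Fin 2)
    (hV : |(V : ℝ) - k * hammingDist x y| ≤ 1 / (4 * D) * (k * hammingDist x y)) :
    IsApprox δ x y (((2 * V + k) / (2 * k) : ℕ) : ℝ) := by
  set h := hammingDist x y with hh
  set W := (2 * V + k) / (2 * k) with hW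
  have hk0 : (0 : ℝ) < k := by exact_mod_cast hk
  have hD0 : (0 : ℝ) < D := by exact_mod_cast hD
  have w1 : W * (2 * k) ≤ 2 * V + k := Nat.div_mul_le_self _ _
  have w2 : 2 * V + k < (W + 1) * (2 * k) := by
    have := Nat.lt_div_mul_add (a := 2 * V + k) (b := 2 * k) (by omega)
    rw [← hW] at this
    rw [add_mul]; omega
  have w1' : (W : ℝ) * (2 * k) ≤ 2 * V + k := by exact_mod_cast w1
  have w2' : 2 * (V : ℝ) + k < (W + 1) * (2 * k) := by exact_mod_cast w2
  obtain ⟨v1, v2⟩ := abs_le.1 hV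
  set e : ℝ := 1 / (4 * D) * h with he
  have he' : 1 / (4 * D) * (k * (h : ℝ)) = k * e := by rw [he]; ring
  rw [he'] at v1 v2
  have u1 : (W : ℝ) ≤ h + e + 1 / 2 := by
    refine le_of_mul_le_mul_left ?_ hk0
    nlinarith
  have u2 : (h : ℝ) - e - 1 / 2 < W := by
    refine lt_of_mul_lt_mul_left ?_ hk0.le
    nlinarith
  have hh0 : (0 : ℝ) ≤ h := Nat.cast_nonneg h
  have hDe : D * e = h / 4 := by rw [he]; field_simp
  by_cases hlt : h < 2 * D
  · have hlt' : (h : ℝ) < 2 * D := by exact_mod_cast hlt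
    have he2 : e < 1 / 2 := by
      refine lt_of_mul_lt_mul_left ?_ hD0.le
      linarith
    have hWh : W = h := by
      have a1 : (W : ℝ) < h + 1 := by linarith
      have a2 : (h : ℝ) < W + 1 := by linarith
      have a1' : W < h + 1 := by exact_mod_cast a1
      have a2' : h < W + 1 := by exact_mod_cast a2
      omega
    rw [hWh]
    exact ⟨div_le_self hh0 (by linarith), by nlinarith⟩
  · have hge : (2 * D : ℝ) ≤ h := by exact_mod_cast not_lt.1 hlt
    have hhq : h ≤ q := by simpa using hammingDist_le_card_fintype (x := x) (y := y)
    have hDδ : (1 : ℝ) < D * δ := hDq.resolve_left (by omega)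
    have e1 : 1 / 2 ≤ e := by
      refine le_of_mul_le_mul_left ?_ hD0
      linarith
    have e2 : e ≤ h * δ / 4 := by
      refine le_of_mul_le_mul_left ?_ hD0
      nlinarith
    constructor
    · rw [div_le_iff₀ (by linarith)]
      have : (h : ℝ) * (1 - δ / 2) ≤ W := by nlinarith
      nlinarith [mul_nonneg hh0 hδ.le, mul_nonneg (mul_nonneg hh0 hδ.le) (sub_nonneg.2 hδ'.le)]
    · nlinarith [mul_nonneg hh0 hδ.le]

theorem precision_spec {q : ℕ} {δ : ℝ} (hδ : 0 < δ) :
    q ≤ precision q δ ∨ (1 : ℝ) < precision q δ * δ := by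
  rw [one_lt_mul_iff hδ]
  unfold precision
  omega

/-- The difference of the `i`-th row of `A` and the `j`-th column of `B`, as a real vector. -/
def difference {p q r : ℕ} (A : Matrix (Fin p) (Fin q) (Fin 2))
    (B : Matrix (Fin q) (Fin r) (Fin 2)) (i : Fin p) (j : Fin r) (t : Fin q) : ℝ :=
  ((A i t : ℕ) : ℝ) - ((B t j : ℕ) : ℝ)

open Classical in
/-- The matrices of bits for which some sketched distance has a relative error above
`1 / (4 D)`. -/
noncomputable def badBits {p q r : ℕ} (A : Matrix (Fin p) (Fin q) (Fin 2))
    (B : Matrix (Fin q) (Fin r) (Fin 2)) (k D : ℕ) : Finset (Fin k → Fin q → Fin 2) :=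
  Finset.univ.biUnion fun ij : Fin p × Fin r => Finset.univ.filter fun b =>
    1 / (4 * (D : ℝ)) * (k * ∑ t, difference A B ij.1 ij.2 t ^ 2)
      < |∑ l, (∑ t, bitSign (b l t) * difference A B ij.1 ij.2 t) ^ 2
          - k * ∑ t, difference A B ij.1 ij.2 t ^ 2|

theorem card_badBits_le {p q r k D : ℕ} (A : Matrix (Fin p) (Fin q) (Fin 2))
    (B : Matrix (Fin q) (Fin r) (Fin 2)) (hD : 1 ≤ D) :
    ((badBits A B k D).card : ℝ)
      ≤ 2 ^ (k * q) * (2 * (p * r) * Real.exp (-(k * (1 / (4 * (D : ℝ))) ^ 2 / 16))) := by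
  have hD1 : (1 : ℝ) ≤ D := by exact_mod_cast hD
  have hε : (1 : ℝ) / (4 * D) ≤ 4 / 5 := by
    rw [div_le_iff₀ (by linarith)]; linarith
  unfold badBits
  refine (Nat.cast_le.2 Finset.card_biUnion_le).trans ?_
  rw [Nat.cast_sum]
  refine (Finset.sum_le_sum fun ij _ =>
    card_bad_sketch_le (difference A B ij.1 ij.2) (by positivity) hε).trans (le_of_eq ?_)
  simp only [Finset.sum_const, Finset.card_univ, Fintype.card_prod, Fintype.card_fin,
    nsmul_eq_mul]
  push_cast
  rw [← pow_mul, mul_comm q k]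
  ring

/-- The output computed by the program is correct unless the drawn bits are bad. -/
theorem outputCorrect_of_notMem_badBits {p q r k D : ℕ} {δ : ℝ} (hδ : 0 < δ) (hδ' : δ < 1 / 2)
    (hk : 1 ≤ k) (hD : 1 ≤ D) (hDq : q ≤ D ∨ (1 : ℝ) < D * δ)
    (A : Matrix (Fin p) (Fin q) (Fin 2)) (B : Matrix (Fin q) (Fin r) (Fin 2)) {ω : Source}
    (hω : drawnBits k q ω ∉ badBits A B k D) {s : State} {β : ℕ → ℕ}
    (hβ : ∀ a < k * q, β a = pick (ω a) 2)
    (hs : ∀ i < p, ∀ j < r, s.mem 3 (i * r + j) = 1 ∧ s.mem 2 (i * r + j) =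
        (2 * ∑ l ∈ Finset.range k,
          distSq (sketchEntry q β (fun t => rowMajor A (i * q + t)) l)
            (sketchEntry q β (fun t => rowMajor B (t * r + j)) l) + k) / (2 * k)) :
    OutputCorrect A B δ s := by
  intro i j
  obtain ⟨h3, h2⟩ := hs i i.2 j j.2
  rw [h3, h2, Nat.cast_one, div_one]
  refine ⟨one_ne_zero, isApprox_round hδ hδ' hk hD hDq _ _ ?_⟩
  have hgood : ¬ (1 / (4 * (D : ℝ)) * (k * ∑ t, difference A B i j t ^ 2)
      < |∑ l, (∑ t, bitSign (drawnBits k q ω l t) * difference A B i j t) ^ 2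
          - k * ∑ t, difference A B i j t ^ 2|) := fun h =>
    hω (by
      unfold badBits
      exact Finset.mem_biUnion.2
        ⟨(i, j), Finset.mem_univ _, Finset.mem_filter.2 ⟨Finset.mem_univ _, h⟩⟩)
  have hham : ∑ t, difference A B i j t ^ 2 = hammingDist (A.row i) (B.col j) :=
    sum_sq_sub_eq_hammingDist (A.row i) (B.col j)
  rw [hham] at hgood
  refine le_trans (le_of_eq ?_) (not_lt.1 hgood)
  congr 2
  rw [Finset.sum_range]
  push_cast
  refine Finset.sum_congr rfl fun l _ => ?_
  rw [cast_distSq, cast_sketchEntry_sub (b := drawnBits k q ω l) (x' := A.row i) (y' := B.col j)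
    (fun t => hβ _ (mul_add_lt_mul l.2 t.2)) (fun t => rowMajor_apply A i t)
    (fun t => rowMajor_apply B t j)]
  rfl

/-! ### Resources -/

section Resources

variable {p q r : ℕ} {δ : ℝ}

theorem log_le_clog (N : ℕ) (hN : 1 ≤ N) : Real.log N ≤ Nat.clog 2 N := by
  have h1 : (N : ℝ) ≤ 2 ^ Nat.clog 2 N := by exact_mod_cast Nat.le_pow_clog one_lt_two N
  have h2 := Real.log_le_log (by exact_mod_cast hN) h1
  rw [Real.log_pow] at h2
  have h3 : (0 : ℝ) ≤ Nat.clog 2 N := Nat.cast_nonneg _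
  nlinarith [Real.log_two_lt_d9]

theorem clog_le_log (N : ℕ) (hN : 4 ≤ N) : (Nat.clog 2 N : ℝ) ≤ 3 * Real.log N := by
  have hpos : 1 ≤ Nat.clog 2 N := Nat.clog_pos one_lt_two (by omega)
  have h1 : (2 : ℝ) ^ (Nat.clog 2 N - 1) ≤ N := by
    exact_mod_cast (Nat.pow_pred_clog_lt_self one_lt_two (x := N) (by omega)).le
  have h2 := Real.log_le_log (by positivity) h1
  rw [Real.log_pow, Nat.cast_sub hpos, Nat.cast_one] at h2
  have h4 : Real.log 2 ≤ Real.log N :=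
    Real.log_le_log two_pos (by exact_mod_cast (by omega : 2 ≤ N))
  nlinarith [Real.log_two_gt_d9]

/-- As `δ < 1/2` and `q ≥ 2`, the factor `log_{1+δ} q` is at least `3/2`, and its logarithm at
least `1/3`. -/
theorem le_three_mul_timeBound (hp : 1 ≤ p) (hq : 2 ≤ q) (hr : 1 ≤ r) (hδ : 0 < δ)
    (hδ' : δ < 1 / 2) :
    Real.log (inputSize p q r) / δ ^ 2 * (inputSize p q r + p * r)
      ≤ 3 * timeBound p q r δ := by
  have hN : (1 : ℝ) ≤ inputSize p q r := by
    exact_mod_cast (by have := four_le_inputSize hp hq hr; omega : 1 ≤ inputSize p q r)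
  have hlogN := Real.log_nonneg hN
  have hq' : (2 : ℝ) ≤ q := by exact_mod_cast hq
  have h1 : 3 / 2 ≤ Real.logb (1 + δ) q := by
    have hl : 0 < Real.log (1 + δ) := Real.log_pos (by linarith)
    rw [Real.logb, le_div_iff₀ hl]
    have a1 : Real.log ((1 + δ) ^ 3) ≤ Real.log ((q : ℝ) ^ 2) := by
      refine Real.log_le_log (by positivity) ?_
      have : (1 + δ) ^ 3 ≤ (3 / 2) ^ 3 := by gcongr; linarith
      nlinarith
    rw [Real.log_pow, Real.log_pow] at a1
    push_cast at a1
    linarith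
  have h2 : 1 / 3 ≤ Real.log (Real.logb (1 + δ) q) := by
    have a1 := Real.one_sub_inv_le_log_of_pos (show (0 : ℝ) < 3 / 2 by norm_num)
    have a2 := Real.log_le_log (show (0 : ℝ) < 3 / 2 by norm_num) h1
    norm_num at a1
    linarith
  unfold timeBound
  rw [mul_left_comm]
  refine mul_le_mul_of_nonneg_left ?_ (by positivity)
  have : (0 : ℝ) ≤ (p : ℝ) * r := by positivity
  nlinarith

theorem sketchSize_le (C : ℕ) (hp : 1 ≤ p) (hq : 2 ≤ q) (hr : 1 ≤ r) (hδ : 0 < δ)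
    (hδ' : δ < 1 / 2) :
    (sketchSize C p q r δ : ℝ) ≤ 12 * C * (Real.log (inputSize p q r) / δ ^ 2) := by
  have hN := four_le_inputSize hp hq hr
  have hL := clog_le_log _ hN
  have hD : (precision q δ : ℝ) ≤ 2 / δ := by
    have h1 : (precision q δ : ℝ) ≤ (⌊1 / δ⌋₊ : ℝ) + 1 := by
      exact_mod_cast (min_le_right _ _ : precision q δ ≤ ⌊1 / δ⌋₊ + 1)
    have h2 : (⌊1 / δ⌋₊ : ℝ) ≤ 1 / δ := Nat.floor_le (by positivity)
    have h3 : 1 ≤ 1 / δ := by rw [le_div_iff₀ hδ]; linarith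
    have h4 : 2 / δ = 1 / δ + 1 / δ := by ring
    linarith
  unfold sketchSize
  push_cast
  calc (C : ℝ) * Nat.clog 2 (inputSize p q r) * precision q δ * precision q δ
      ≤ C * (3 * Real.log (inputSize p q r)) * (2 / δ) * (2 / δ) := by gcongr
    _ = _ := by field_simp; ring

/-- All words that occur are polynomial in `N`. -/
theorem word_bound {C c : ℕ} (hp : 1 ≤ p) (hq : 2 ≤ q) (hr : 1 ≤ r) (hc : 3 * C + 17 ≤ c) :
    8 * (sketchSize C p q r δ * (inputSize p q r * inputSize p q r)) ^ 3
      ≤ inputSize p q r ^ c := by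
  have hN4 := four_le_inputSize hp hq hr
  have hqN : q + 1 ≤ inputSize p q r := by
    unfold inputSize; nlinarith
  set N := inputSize p q r with hN
  have h1 : C ≤ N ^ C :=
    Nat.lt_two_pow_self.le.trans (Nat.pow_le_pow_left (by omega) C)
  have h2 : Nat.clog 2 N ≤ N := Nat.clog_le_of_le_pow Nat.lt_two_pow_self.le
  have h3 : precision q δ ≤ N := (min_le_left _ _).trans hqN
  have h4 : sketchSize C p q r δ ≤ N ^ C * N * N * N :=
    Nat.mul_le_mul (Nat.mul_le_mul (Nat.mul_le_mul h1 h2) h3) h3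
  have h5 : 8 ≤ N ^ 2 := by nlinarith
  calc 8 * (sketchSize C p q r δ * (N * N)) ^ 3
      ≤ N ^ 2 * (N ^ C * N * N * N * (N * N)) ^ 3 := by gcongr
    _ = N ^ (3 * C + 17) := by ring
    _ ≤ N ^ c := Nat.pow_le_pow_right (by omega) hc

/-- With `C = 256 (a + 2)` the union bound over the `p r ≤ N² / 2` pairs leaves a failure
probability of at most `N ^ (-a)`. -/
theorem union_bound_le {α : ℝ} {a : ℕ} (ha : α ≤ a) (hp : 1 ≤ p) (hq : 2 ≤ q) (hr : 1 ≤ r) :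
    2 * (p * r) * Real.exp (-(sketchSize (256 * (a + 2)) p q r δ *
      (1 / (4 * (precision q δ : ℝ))) ^ 2 / 16)) ≤ 1 / (inputSize p q r : ℝ) ^ α := by
  have hN4 := four_le_inputSize hp hq hr
  have hlog := log_le_clog (inputSize p q r) (by omega)
  have hpr : 2 * (p * r) ≤ inputSize p q r ^ 2 := by
    have h1 : p + r ≤ inputSize p q r := by unfold inputSize; nlinarith
    nlinarith [Nat.pow_le_pow_left h1 2]
  set N := inputSize p q r with hN
  have hN0 : (0 : ℝ) < N := by exact_mod_cast (by omega : 0 < N)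
  have hD : (0 : ℝ) < precision q δ := by exact_mod_cast one_le_precision
  have hexp : (sketchSize (256 * (a + 2)) p q r δ : ℝ) * (1 / (4 * (precision q δ : ℝ))) ^ 2 / 16
      = (a + 2) * Nat.clog 2 N := by
    unfold sketchSize
    push_cast
    field_simp
    ring
  have hlog0 : 0 ≤ Real.log N := Real.log_nonneg (by exact_mod_cast (by omega : 1 ≤ N))
  have hle : Real.exp (-((a + 2) * Nat.clog 2 N)) ≤ 1 / (N : ℝ) ^ α * (1 / (N : ℝ) ^ 2) := by
    calc Real.exp (-((a + 2) * Nat.clog 2 N)) ≤ Real.exp (-(Real.log N * α + Real.log N * 2)) := by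
          refine Real.exp_le_exp.2 (neg_le_neg ?_)
          have : (0 : ℝ) ≤ a := Nat.cast_nonneg a
          nlinarith
      _ = 1 / (N : ℝ) ^ α * (1 / (N : ℝ) ^ 2) := by
          rw [neg_add, Real.exp_add, Real.exp_neg, Real.exp_neg, ← Real.rpow_def_of_pos hN0,
            ← Real.rpow_def_of_pos hN0, Real.rpow_two, one_div, one_div]
  rw [hexp]
  calc 2 * ((p : ℝ) * r) * Real.exp (-((a + 2) * Nat.clog 2 N))
      ≤ (N : ℝ) ^ 2 * (1 / (N : ℝ) ^ α * (1 / (N : ℝ) ^ 2)) := by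
        gcongr
        exact_mod_cast hpr
    _ = _ := by field_simp

end Resources

theorem sourceMeasure_badBits_le {p q r k D : ℕ} (A : Matrix (Fin p) (Fin q) (Fin 2))
    (B : Matrix (Fin q) (Fin r) (Fin 2)) (hD : 1 ≤ D) :
    sourceMeasure {ω | drawnBits k q ω ∈ badBits A B k D} ≤ ENNReal.ofReal
      (2 * (p * r) * Real.exp (-(k * (1 / (4 * (D : ℝ))) ^ 2 / 16))) := by
  refine (sourceMeasure_drawnBits_mem_le _).trans ?_
  have e : ((badBits A B k D).card : ENNReal) * (1 / 2) ^ (k * q)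
      = ENNReal.ofReal ((badBits A B k D).card * (1 / 2) ^ (k * q)) := by
    rw [ENNReal.ofReal_mul (Nat.cast_nonneg _), ENNReal.ofReal_natCast,
      ENNReal.ofReal_pow (by norm_num), ENNReal.ofReal_div_of_pos two_pos]
    simp
  rw [e]
  refine ENNReal.ofReal_le_ofReal ?_
  calc ((badBits A B k D).card : ℝ) * (1 / 2) ^ (k * q)
      ≤ 2 ^ (k * q) * (2 * (p * r) * Real.exp (-(k * (1 / (4 * (D : ℝ))) ^ 2 / 16)))
          * (1 / 2) ^ (k * q) := by
        gcongr
        exact card_badBits_le A B hD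
    _ = _ := by
        rw [mul_right_comm, ← mul_pow]
        norm_num

end ApproxHamming

theorem mainTheorem2 (α : ℝ) (hα : 1 ≤ α) :
    ∃ (P : WordRAM.Prog) (c : ℕ),
      ∀ (p q r : ℕ), 1 ≤ p → 2 ≤ q → 1 ≤ r →
      ∀ (A : Matrix (Fin p) (Fin q) (Fin 2)) (B : Matrix (Fin q) (Fin r) (Fin 2)) (δ : ℝ),
        0 < δ → δ < 1 / 2 →
        (∀ ω : WordRAM.Source, ∃ (s : WordRAM.State) (T : ℕ),
          WordRAM.Exec (ApproxHamming.inputSize p q r ^ c) δ ω P (ApproxHamming.input A B) s T ∧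
            (T : ℝ) ≤ c * ApproxHamming.timeBound p q r δ) ∧
        WordRAM.sourceMeasure {ω : WordRAM.Source | ∃ (s : WordRAM.State) (T : ℕ),
          WordRAM.Exec (ApproxHamming.inputSize p q r ^ c) δ ω P (ApproxHamming.input A B) s T ∧
            ¬ ApproxHamming.OutputCorrect A B δ s} ≤
          ENNReal.ofReal (1 / (ApproxHamming.inputSize p q r : ℝ) ^ α) := by
  open ApproxHamming WordRAM in
  set C := 256 * (⌈α⌉₊ + 2) with hC
  refine ⟨program C, 36000 * C, fun p q r hp hq hr A B δ hδ hδ' => ?_⟩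
  have hM : 8 * (sketchSize C p q r δ * (inputSize p q r * inputSize p q r)) ^ 3
      ≤ inputSize p q r ^ (36000 * C) := word_bound hp hq hr (by omega)
  have hexec := fun ω : Source =>
    exec_program (ω := ω) hp hq hr hδ (show 1 ≤ C by omega) A B hM
  constructor
  · intro ω
    obtain ⟨s, T, hT, hE, -⟩ := hexec ω
    refine ⟨s, T, hE, ?_⟩
    have hT' : (T : ℝ) ≤ 1000 * (sketchSize C p q r δ * (inputSize p q r + p * r)) := by
      exact_mod_cast hT
    have h1 := sketchSize_le C hp hq hr hδ hδ'
    have h2 := le_three_mul_timeBound hp hq hr hδ hδ'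
    calc (T : ℝ) ≤ 1000 * (12 * C * (Real.log (inputSize p q r) / δ ^ 2)
          * (inputSize p q r + p * r)) := hT'.trans (by gcongr)
      _ = 12000 * C * (Real.log (inputSize p q r) / δ ^ 2 * (inputSize p q r + p * r)) := by ring
      _ ≤ 12000 * C * (3 * timeBound p q r δ) := by gcongr
      _ = _ := by push_cast; ring
  · refine (MeasureTheory.measure_mono fun ω hω => ?_).trans
      ((sourceMeasure_badBits_le (k := sketchSize C p q r δ) (D := precision q δ) A B
        one_le_precision).trans
        (ENNReal.ofReal_le_ofReal (union_bound_le (Nat.le_ceil α) hp hq hr)))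
    obtain ⟨s, T, hE, hbad⟩ := hω
    by_contra hgood
    obtain ⟨s', T', -, hE', β, hβ, hs⟩ := hexec ω
    obtain ⟨rfl, -⟩ := hE.unique hE'
    have hk : C ≤ sketchSize C p q r δ :=
      le_sketchSize (by have := four_le_inputSize hp hq hr; omega)
    exact hbad (outputCorrect_of_notMem_badBits hδ hδ' (by omega) one_le_precision
      (precision_spec hδ) A B hgood hβ hs)
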